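/- Let $(X,d,\mu)$ be a metric space with a Borel measure $\mu$ for which nonempty open sets have positive measure, bounded sets have finite measure, and $\mu(B(x,2r))\le c_d\,\mu(B(x,r))$ for all balls $B(x,r)=\{y:d(x,y)<r\}$. Assume the measure lower bound $\mu(B(x,r))\ge c_l r^Q$ for all $x\in X$, $r>0$, where $c_l>0$. Let $1<p<Q$, $1\le\alpha<Q/p$, $p^*=\frac{Qp}{Q-\alpha p}$, $q=\frac{Qp}{Q-(\alpha-1)p}$, let $\Omega\subset X$ be open with $X\setminus\Omega\neq\emptyset$, and let $u\in L^p(\Omega)$. For $\beta\ge 0$ and $x\in\Omega$ put $$\mathcal M_{\beta,\Omega}u(x)=\sup_{0<r<\operatorname{dist}(x,X\setminus\Omega)} r^{\beta}\,\frac1{\mu(B(x,r))}\int_{B(x,r)}|u|\,d\mu .$$ For every rational $t\in(0,1)$ choose a Whitney covering of $\Omega$ at scale $t$, i.e. countably many balls $B_i=B(x_i,r_i)$ with $x_i\in\Omega$, $r_i=\frac{t}{18}\operatorname{dist}(x_i,X\setminus\Omega)$, $\bigcup_iB_i=\Omega$ and $\sum_i\chi_{6B_i}\le N$ on $\Omega$,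 and a related partition of unity, i.e. functions $\varphi_i:X\to[0,1]$ with $\sum_i\varphi_i=1$ on $\Omega$, $\varphi_i=0$ outside $6B_i$, $\varphi_i\ge\nu$ on $3B_i$ and $\varphi_i$ Lipschitz with constant $L/r_i$. Here $N\in\mathbb N$ and $\nu,L>0$ are fixed constants, the same for all scales (for suitable $N,\nu,L$ depending only on $c_d$, such coverings and partitions always exist). With $$|u|_t^\alpha(x)=\sum_i\varphi_i(x)\,r_i^\alpha\,\frac1{\mu(3B_i)}\int_{3B_i}|u|\,d\mu,$$ the local discrete fractional maximal function of $u$ is $\mathcal M^*_{\alpha,\Omega}u(x)=\sup_{t\in\mathbb Q\cap(0,1)}|u|_t^\alpha(x)$. A curve is a nonconstant, rectifiable, continuous map from a compact interval to $X$. A measurable function $g\ge0$ is an $s$-weak upper gradient of $v$ on $\Omega$ if for every curve $\gamma$ in $\Omega$, with endpoints $x,y$, outside a family of curves of zero $s$-modulus, $|v(x)-v(y)|\le\int_\gamma g\,ds$ when $v(x)$ and $v(y)$ are both finite, and $\int_\gamma g\,ds=\infty$ otherwise. **Theorem.** There is a constant $C>0$, depending only on $c_d$, $c_l$, $Q$,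 $p$, $\alpha$ (and on $N,\nu,L$, which can be chosen to depend only on $c_d$), and not on the choice of the coverings and partitions of unity, such that $\mathcal M^*_{\alpha,\Omega}u$ and $\mathcal M_{\alpha-1,\Omega}u$ are measurable on $\Omega$, the function $C\,\mathcal M_{\alpha-1,\Omega}u$ is an $s$-weak upper gradient of $\mathcal M^*_{\alpha,\Omega}u$ on $\Omega$ for every $1\le s<\infty$, and $$\|\mathcal M^*_{\alpha,\Omega}u\|_{L^{p^*}(\Omega)}\le C\|u\|_{L^p(\Omega)},\qquad \|\mathcal M_{\alpha-1,\Omega}u\|_{L^q(\Omega)}\le C\|u\|_{L^p(\Omega)}.$$ -/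

import Mathlib

open MeasureTheory Set
open scoped ENNReal

noncomputable section

/-- The standing assumptions on the measure of a doubling metric measure space: `μ` is doubling with
constant `cd`, nonempty open sets have positive measure, bounded sets have finite measure. -/
structure IsDoublingMeasure {X : Type*} [MetricSpace X] [MeasurableSpace X] (μ : Measure X)
    (cd : ℝ) : Prop where
  doubling : ∀ (x : X) (r : ℝ), 0 < r →
    μ (Metric.ball x (2 * r)) ≤ ENNReal.ofReal cd * μ (Metric.ball x r)
  pos_of_isOpen : ∀ U : Set X, IsOpen U → U.Nonempty → 0 < μ U
  lt_top_of_isBounded : ∀ A : Set X, Bornology.IsBounded A → μ A < ∞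

/-- The measure lower bound condition `μ(B(x,r)) ≥ cl * r ^ Q`. -/
def MeasureLowerBound {X : Type*} [MetricSpace X] [MeasurableSpace X] (μ : Measure X)
    (cl Q : ℝ) : Prop :=
  ∀ (x : X) (r : ℝ), 0 < r → ENNReal.ofReal (cl * r ^ Q) ≤ μ (Metric.ball x r)

/-- A curve: a nonconstant, rectifiable, continuous mapping from a compact interval to `X`.
(The values of `toFun` outside `[a, b]` play no role.) -/
structure RectifiableCurve (X : Type*) [MetricSpace X] where
  a : ℝ
  b : ℝ
  a_lt_b : a < b
  toFun : ℝ → X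
  continuousOn : ContinuousOn toFun (Icc a b)
  rectifiable : eVariationOn toFun (Icc a b) ≠ ∞
  nonconstant : ∃ s ∈ Icc a b, ∃ t ∈ Icc a b, toFun s ≠ toFun t

namespace RectifiableCurve

variable {X : Type*} [MetricSpace X]

/-- The image of the curve. -/
def image (γ : RectifiableCurve X) : Set X := γ.toFun '' Icc γ.a γ.b

/-- The length of the curve. -/
def length (γ : RectifiableCurve X) : ℝ := (eVariationOn γ.toFun (Icc γ.a γ.b)).toReal

/-- The line integral `∫_γ g ds`: the integral of `g` along the arc length parametrization of `γ`
over `[0, length γ]`. -/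
def lineIntegral (γ : RectifiableCurve X) (g : X → ℝ≥0∞) : ℝ≥0∞ :=
  ∫⁻ s in Icc 0 γ.length, g (naturalParameterization γ.toFun (Icc γ.a γ.b) γ.a s)

end RectifiableCurve

/-- The `s`-modulus of a family of curves: the infimum of `∫ ρ ^ s dμ` over the nonnegative Borel
functions `ρ` with `∫_γ ρ ds ≥ 1` for all `γ ∈ Γ`. -/
def curveModulus {X : Type*} [MetricSpace X] [MeasurableSpace X] (μ : Measure X) (s : ℝ)
    (Γ : Set (RectifiableCurve X)) : ℝ≥0∞ :=
  ⨅ (ρ : X → ℝ≥0∞) (_ : Measurable ρ) (_ : ∀ γ ∈ Γ, 1 ≤ γ.lineIntegral ρ), ∫⁻ x, ρ x ^ s ∂μ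

/-- The upper gradient inequality for `v` and `g` on one curve: with `x`, `y` the endpoints,
`|v x - v y| ≤ ∫_γ g ds` if `v x` and `v y` are both finite, and `∫_γ g ds = ∞` otherwise. -/
def UpperGradientInequality {X : Type*} [MetricSpace X] (v : X → EReal) (g : X → ℝ≥0∞)
    (γ : RectifiableCurve X) : Prop :=
  let x := γ.toFun γ.a
  let y := γ.toFun γ.b
  ((v x ≠ ⊤ ∧ v x ≠ ⊥ ∧ v y ≠ ⊤ ∧ v y ≠ ⊥) →
    ENNReal.ofReal |(v x).toReal - (v y).toReal| ≤ γ.lineIntegral g) ∧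
  (¬ (v x ≠ ⊤ ∧ v x ≠ ⊥ ∧ v y ≠ ⊤ ∧ v y ≠ ⊥) → γ.lineIntegral g = ∞)

/-- `g` is an `s`-weak upper gradient of `v` on `Ω`: `g` is a nonnegative measurable function, and
the upper gradient inequality fails only for a family of curves in `Ω` of zero `s`-modulus. -/
def IsWeakUpperGradientOn {X : Type*} [MetricSpace X] [MeasurableSpace X] (μ : Measure X) (s : ℝ)
    (Ω : Set X) (v : X → EReal) (g : X → ℝ≥0∞) : Prop :=
  AEMeasurable g (μ.restrict Ω) ∧
    curveModulus μ s {γ | γ.image ⊆ Ω ∧ ¬ UpperGradientInequality v g γ} = 0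

/-- The local fractional maximal function `M_{α,Ω} u(x)`, the supremum of `r ^ α ⨍_{B(x,r)} |u| dμ`
over `0 < r < dist(x, X \ Ω)` (over all `r > 0` if `Ω = X`). -/
def localFractionalMaximal {X : Type*} [MetricSpace X] [MeasurableSpace X] (μ : Measure X)
    (α : ℝ) (Ω : Set X) (u : X → ℝ) (x : X) : ℝ≥0∞ :=
  ⨆ (r : ℝ) (_ : 0 < r) (_ : ENNReal.ofReal r < Metric.infEDist x Ωᶜ),
    ENNReal.ofReal (r ^ α) * ⨍⁻ y in Metric.ball x r, ‖u y‖ₑ ∂μ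

/-- A Whitney covering of `Ω` at scale `t`: countably many balls `B_i = B(x_i, r_i)`, `x_i ∈ Ω`, with
`r_i = (t / 18) dist(x_i, X \ Ω)`, which cover exactly `Ω` and such that every point of `Ω` lies in
at most `N` of the balls `6 B_i`. -/
structure WhitneyCovering {X : Type*} [MetricSpace X] (Ω : Set X) (t : ℝ) (N : ℕ) where
  ι : Type
  countable : Countable ι
  center : ι → X
  center_mem : ∀ i, center i ∈ Ω
  cover : ⋃ i, Metric.ball (center i) (t / 18 * Metric.infDist (center i) Ωᶜ) = Ω
  overlap : ∀ x ∈ Ω,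
    {i | x ∈ Metric.ball (center i) (6 * (t / 18 * Metric.infDist (center i) Ωᶜ))}.encard ≤ N

/-- The radius `r_i` of the `i`-th ball of a Whitney covering. -/
def WhitneyCovering.radius {X : Type*} [MetricSpace X] {Ω : Set X} {t : ℝ} {N : ℕ}
    (W : WhitneyCovering Ω t N) (i : W.ι) : ℝ :=
  t / 18 * Metric.infDist (W.center i) Ωᶜ

/-- A Lipschitz partition of unity related to a Whitney covering, with constants `ν` and `L`. -/
structure WhitneyPartition {X : Type*} [MetricSpace X] {Ω : Set X} {t : ℝ} {N : ℕ}
    (W : WhitneyCovering Ω t N) (ν L : ℝ) where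
  φ : W.ι → X → ℝ
  nonneg : ∀ i x, 0 ≤ φ i x
  le_one : ∀ i x, φ i x ≤ 1
  eq_zero : ∀ i x, x ∉ Metric.ball (W.center i) (6 * W.radius i) → φ i x = 0
  lower_bound : ∀ i, ∀ x ∈ Metric.ball (W.center i) (3 * W.radius i), ν ≤ φ i x
  lipschitz : ∀ i x y, |φ i x - φ i y| ≤ L / W.radius i * dist x y
  hasSum_one : ∀ x ∈ Ω, HasSum (fun i => φ i x) 1

/-- Existence of Whitney coverings and of related partitions of unity, with constants that depend only
on the doubling constant. -/
theorem exists_whitneyCovering_whitneyPartition (cd : ℝ) :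
    ∃ (N : ℕ) (ν L : ℝ), 0 < ν ∧ 0 < L ∧
      ∀ (X : Type*) [MetricSpace X] [MeasurableSpace X] [BorelSpace X] (μ : Measure X)
        (Ω : Set X) (t : ℝ), IsDoublingMeasure μ cd → IsOpen Ω → Ωᶜ.Nonempty → 0 < t → t < 1 →
        ∃ W : WhitneyCovering Ω t N, Nonempty (WhitneyPartition W ν L) := by
  obtain ⟨N, hN1, hN⟩ : ∃ N : ℕ, 1 ≤ N ∧ cd ^ 8 ≤ N := by
    obtain ⟨n, hn⟩ := exists_nat_ge (cd ^ 8)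
    exact ⟨n + 1, by omega, by push_cast; linarith⟩
  have hN0 : (0 : ℝ) < N := by exact_mod_cast hN1
  refine ⟨N, 1 / N, 1 + 2 * N, by positivity, by positivity, ?_⟩
  intro X _ _ _ μ Ω t hμ hΩ hΩc ht0 ht1
  set r : X → ℝ := fun x => t / 18 * Metric.infDist x Ωᶜ with hr
  have hrpos : ∀ x ∈ Ω, 0 < r x := fun x hx => by
    have : 0 < Metric.infDist x Ωᶜ :=
      (hΩ.isClosed_compl.notMem_iff_infDist_pos hΩc).1 (by simpa using hx)
    positivity
  have hrnn : ∀ x, 0 ≤ r x := fun x => by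
    have : 0 ≤ Metric.infDist x Ωᶜ := Metric.infDist_nonneg
    positivity
  have hrlip : ∀ x y, r x ≤ r y + dist x y / 18 := fun x y => by
    have h1 := Metric.infDist_le_infDist_add_dist (s := Ωᶜ) (x := x) (y := y)
    have h2 : 0 ≤ dist x y := dist_nonneg
    have h3 : t * Metric.infDist x Ωᶜ ≤ t * (Metric.infDist y Ωᶜ + dist x y) := by gcongr
    have h4 : t * dist x y ≤ 1 * dist x y := by gcongr
    simp only [hr]
    linarith
  have hball6 : ∀ x y, dist y x < 6 * r x → y ∈ Ω := fun x y h => by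
    by_contra hy
    have h0 : r y = 0 := by
      simp only [hr]
      rw [Metric.infDist_zero_of_mem (by simpa using hy)]; simp
    have := hrlip x y
    have h3 := hrnn x
    rw [dist_comm] at this
    linarith
  -- a maximal separated set
  obtain ⟨S, hS⟩ := zorn_subset
    {S : Set X | S ⊆ Ω ∧ ∀ x ∈ S, ∀ y ∈ S, x ≠ y → r x + r y ≤ 5 * dist x y} (by
      intro c hc hchain
      refine ⟨⋃₀ c, ⟨?_, ?_⟩, fun s hs => subset_sUnion_of_mem hs⟩
      · exact sUnion_subset fun s hs => (hc hs).1
      · rintro x ⟨s, hs, hxs⟩ y ⟨s', hs', hys'⟩ hxy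
        rcases hchain.total hs hs' with h | h
        · exact (hc hs').2 x (h hxs) y hys' hxy
        · exact (hc hs).2 x hxs y (h hys') hxy)
  have hSΩ : S ⊆ Ω := hS.prop.1
  have hsep := hS.prop.2
  have hcov : ∀ x ∈ Ω, ∃ y ∈ S, dist x y < r y := fun x hx => by
    by_contra! hcon
    have hmem : insert x S ∈
        {S : Set X | S ⊆ Ω ∧ ∀ x ∈ S, ∀ y ∈ S, x ≠ y → r x + r y ≤ 5 * dist x y} := by
      have key : ∀ y ∈ S, r x + r y ≤ 5 * dist x y := fun y hy => by
        have h1 := hcon y hy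
        have h2 := hrlip x y
        linarith [hrnn y]
      refine ⟨insert_subset hx hSΩ, ?_⟩
      rintro a (rfl | ha) b (rfl | hb) hab
      · exact absurd rfl hab
      · exact key b hb
      · rw [add_comm, dist_comm]; exact key a ha
      · exact hsep a ha b hb hab
    have hxS : x ∈ S := hS.le_of_ge hmem (subset_insert x S) (mem_insert x S)
    have := hcon x hxS
    rw [dist_self] at this
    linarith [hrpos x hx]
  have hdisj : ∀ x ∈ S, ∀ y ∈ S, x ≠ y →
      Disjoint (Metric.ball x (r x / 10)) (Metric.ball y (r y / 10)) := fun x hx y hy hxy => by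
    refine Metric.ball_disjoint_ball ?_
    linarith [hsep x hx y hy hxy, hrnn x, hrnn y]
  have hfin : ∀ (x : X) (ρ : ℝ), μ (Metric.ball x ρ) < ∞ := fun x ρ =>
    hμ.lt_top_of_isBounded _ Metric.isBounded_ball
  have hdoub : ∀ (n : ℕ) (x : X) (ρ : ℝ), 0 < ρ →
      μ (Metric.ball x (2 ^ n * ρ)) ≤ ENNReal.ofReal cd ^ n * μ (Metric.ball x ρ) := by
    intro n x ρ hρ
    induction n with
    | zero => simp
    | succ n ih =>
      calc μ (Metric.ball x (2 ^ (n + 1) * ρ)) = μ (Metric.ball x (2 * (2 ^ n * ρ))) := by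
            congr 2; ring
        _ ≤ ENNReal.ofReal cd * μ (Metric.ball x (2 ^ n * ρ)) := hμ.doubling _ _ (by positivity)
        _ ≤ ENNReal.ofReal cd * (ENNReal.ofReal cd ^ n * μ (Metric.ball x ρ)) := by gcongr
        _ = _ := by ring
  -- radii of balls containing a common point are comparable
  have hcomp : ∀ x y, dist x y < 6 * r y → 3 / 4 * r x ≤ r y ∧ r y ≤ 3 / 2 * r x :=
    fun x y h => by
      have h1 := hrlip x y
      have h2 := hrlip y x
      rw [dist_comm y x] at h2
      constructor <;> linarith
  have hcard : ∀ x ∈ Ω, ∀ F : Finset X, (∀ y ∈ F, y ∈ S ∧ dist x y < 6 * r y) →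
      F.card ≤ N := by
    intro x hx F hF
    have hrx := hrpos x hx
    have hM0 : μ (Metric.ball x (10 * r x)) ≠ 0 :=
      (hμ.pos_of_isOpen _ Metric.isOpen_ball ⟨x, Metric.mem_ball_self (by positivity)⟩).ne'
    have hM1 := (hfin x (10 * r x)).ne
    have h1 : ∀ y ∈ F, μ (Metric.ball x (10 * r x)) ≤
        ENNReal.ofReal cd ^ 8 * μ (Metric.ball y (r y / 10)) := fun y hy => by
      obtain ⟨hyS, hd⟩ := hF y hy
      obtain ⟨c1, c2⟩ := hcomp x y hd
      refine le_trans (measure_mono ?_) (hdoub 8 y (r y / 10) (by linarith))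
      refine Metric.ball_subset_ball' ?_
      linarith
    have h2 : ∑ y ∈ F, μ (Metric.ball y (r y / 10)) ≤ μ (Metric.ball x (10 * r x)) := by
      rw [← measure_biUnion_finset
        (fun a ha b hb hab => hdisj a (hF a ha).1 b (hF b hb).1 hab)
        (fun _ _ => Metric.isOpen_ball.measurableSet)]
      refine measure_mono (iUnion₂_subset fun y hy => Metric.ball_subset_ball' ?_)
      obtain ⟨hyS, hd⟩ := hF y hy
      obtain ⟨c1, c2⟩ := hcomp x y hd
      rw [dist_comm]
      linarith
    have h3 : (F.card : ℝ≥0∞) * μ (Metric.ball x (10 * r x)) ≤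
        ENNReal.ofReal cd ^ 8 * μ (Metric.ball x (10 * r x)) := by
      calc (F.card : ℝ≥0∞) * μ (Metric.ball x (10 * r x))
          = ∑ y ∈ F, μ (Metric.ball x (10 * r x)) := by simp
        _ ≤ ∑ y ∈ F, ENNReal.ofReal cd ^ 8 * μ (Metric.ball y (r y / 10)) := Finset.sum_le_sum h1
        _ = ENNReal.ofReal cd ^ 8 * ∑ y ∈ F, μ (Metric.ball y (r y / 10)) := by
            rw [Finset.mul_sum]
        _ ≤ _ := by gcongr
    have h4 : (F.card : ℝ≥0∞) ≤ ENNReal.ofReal cd ^ 8 :=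
      (ENNReal.mul_le_mul_iff_left hM0 hM1).1 h3
    have h5 : ENNReal.ofReal cd ^ 8 ≤ (N : ℝ≥0∞) := by
      rcases le_total 0 cd with h | h
      · rw [← ENNReal.ofReal_pow h, ← ENNReal.ofReal_natCast]
        exact ENNReal.ofReal_le_ofReal hN
      · rw [ENNReal.ofReal_of_nonpos h]; simp
    exact_mod_cast h4.trans h5
  have hoverS : ∀ x ∈ Ω, {y | y ∈ S ∧ dist x y < 6 * r y}.encard ≤ N := fun x hx => by
    refine Set.encard_le_coe_iff_finite_ncard_le.2 ?_
    have hf : {y | y ∈ S ∧ dist x y < 6 * r y}.Finite := by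
      by_contra hinf
      obtain ⟨F, hF, hc⟩ := Set.Infinite.exists_subset_card_eq hinf (N + 1)
      have := hcard x hx F (fun y hy => hF hy)
      omega
    refine ⟨hf, ?_⟩
    rw [Set.ncard_eq_toFinset_card _ hf]
    exact hcard x hx _ (fun y hy => by simpa using hy)
  -- countability
  have hScount : S.Countable := by
    rcases isEmpty_or_nonempty X with hX | ⟨⟨x₀⟩⟩
    · exact (Set.to_countable S)
    have hσ : SigmaFinite μ := ⟨⟨⟨fun n => Metric.ball x₀ n, fun _ => trivial,
      fun n => hfin _ _, Metric.iUnion_ball_nat x₀⟩⟩⟩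
    have := Measure.countable_meas_pos_of_disjoint_iUnion (μ := μ)
      (As := fun x : S => Metric.ball (x : X) (r x / 10))
      (fun _ => Metric.isOpen_ball.measurableSet)
      (fun x y hxy => hdisj x x.2 y y.2 (fun h => hxy (Subtype.ext h)))
    have huniv : {i : S | 0 < μ (Metric.ball (i : X) (r i / 10))} = univ := by
      ext i
      simp only [mem_ofPred_eq, mem_univ, iff_true]
      have := hrpos i (hSΩ i.2)
      exact hμ.pos_of_isOpen _ Metric.isOpen_ball ⟨i, Metric.mem_ball_self (by positivity)⟩
    rw [huniv] at this
    exact (Set.countable_coe_iff).1 (Set.countable_univ_iff.1 this)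
  obtain ⟨f, hf⟩ := (Set.countable_coe_iff.2 hScount).exists_injective_nat
  let e : S ≃ range f := Equiv.ofInjective f hf
  have hover : ∀ x ∈ Ω, {i : range f | dist x (e.symm i : X) < 6 * r (e.symm i : X)}.encard ≤ N := by
    intro x hx
    refine le_trans ?_ (hoverS x hx)
    refine Set.encard_le_encard_of_injOn (f := fun i => (e.symm i : X)) ?_ ?_
    · intro i hi
      exact ⟨(e.symm i).2, hi⟩
    · intro i _ j _ hij
      exact e.symm.injective (Subtype.ext hij)
  let W : WhitneyCovering Ω t N :=
    { ι := range f
      countable := inferInstance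
      center := fun i => (e.symm i : X)
      center_mem := fun i => hSΩ (e.symm i).2
      cover := by
        ext x
        simp only [mem_iUnion, Metric.mem_ball]
        constructor
        · rintro ⟨i, hi⟩
          exact hball6 (e.symm i) x (by
            have := hrnn (e.symm i)
            simp only [hr] at this ⊢
            linarith)
        · intro hx
          obtain ⟨y, hy, hd⟩ := hcov x hx
          exact ⟨e ⟨y, hy⟩, by simpa [hr] using hd⟩
      overlap := hover }
  refine ⟨W, ⟨?_⟩⟩
  have hWr : ∀ i, W.radius i = r (W.center i) := fun i => rfl
  have hWpos : ∀ i, 0 < W.radius i := fun i => hrpos _ (W.center_mem i)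
  -- the cut-off functions
  let ψ : W.ι → X → ℝ := fun i x => max 0 (min 1 (2 - dist x (W.center i) / (3 * W.radius i)))
  have hψ0 : ∀ i x, 0 ≤ ψ i x := fun i x => le_max_left _ _
  have hψ1 : ∀ i x, ψ i x ≤ 1 := fun i x => max_le zero_le_one (min_le_left _ _)
  have hψin : ∀ i x, dist x (W.center i) ≤ 3 * W.radius i → ψ i x = 1 := fun i x h => by
    have h1 : dist x (W.center i) / (3 * W.radius i) ≤ 1 :=
      (div_le_one (by linarith [hWpos i])).2 h
    simp only [ψ]
    rw [min_eq_left (by linarith), max_eq_right zero_le_one]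
  have hψout : ∀ i x, 6 * W.radius i ≤ dist x (W.center i) → ψ i x = 0 := fun i x h => by
    have h1 : 2 ≤ dist x (W.center i) / (3 * W.radius i) :=
      (le_div_iff₀ (by linarith [hWpos i])).2 (by linarith)
    simp only [ψ]
    exact max_eq_left (le_trans (min_le_right _ _) (by linarith))
  have hψlip : ∀ i x y, |ψ i x - ψ i y| ≤ dist x y / (3 * W.radius i) := fun i x y => by
    have h3 : 0 < 3 * W.radius i := by linarith [hWpos i]
    simp only [ψ]
    rw [max_comm (0 : ℝ), max_comm (0 : ℝ)]
    refine (abs_max_sub_max_le_abs _ _ _).trans ?_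
    refine (abs_min_sub_min_le_max _ _ _ _).trans ?_
    refine max_le (by simp; positivity) ?_
    have : (2 - dist x (W.center i) / (3 * W.radius i)) -
        (2 - dist y (W.center i) / (3 * W.radius i)) =
        (dist y (W.center i) - dist x (W.center i)) / (3 * W.radius i) := by ring
    rw [this, abs_div, abs_of_pos h3]
    gcongr
    rw [dist_comm x y]
    exact abs_dist_sub_le _ _ _
  have hfinset : ∀ x ∈ Ω, ∃ F : Finset W.ι, F.card ≤ N ∧ ∀ i ∉ F, ψ i x = 0 := fun x hx => by
    obtain ⟨h1, h2⟩ := Set.encard_le_coe_iff_finite_ncard_le.1 (W.overlap x hx)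
    refine ⟨h1.toFinset, ?_, fun i hi => hψout i x ?_⟩
    · rwa [← Set.ncard_eq_toFinset_card _ h1]
    · by_contra! hcon
      exact hi (h1.mem_toFinset.2 hcon)
  have hsummable : ∀ x ∈ Ω, Summable fun i => ψ i x := fun x hx => by
    obtain ⟨F, _, hF⟩ := hfinset x hx
    exact summable_of_ne_finset_zero hF
  let T : X → ℝ := fun x => ∑' i, ψ i x
  have hT1 : ∀ x ∈ Ω, 1 ≤ T x := fun x hx => by
    have : x ∈ ⋃ i, Metric.ball (W.center i) (W.radius i) := by
      have := W.cover
      exact this.symm ▸ hx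
    obtain ⟨i, hi⟩ := mem_iUnion.1 this
    rw [← hψin i x (by linarith [Metric.mem_ball.1 hi, hWpos i])]
    exact (hsummable x hx).le_tsum i (fun j _ => hψ0 j x)
  have hTN : ∀ x ∈ Ω, T x ≤ N := fun x hx => by
    obtain ⟨F, hc, hF⟩ := hfinset x hx
    calc T x = ∑ i ∈ F, ψ i x := tsum_eq_sum hF
      _ ≤ ∑ i ∈ F, (1 : ℝ) := Finset.sum_le_sum fun i _ => hψ1 i x
      _ = F.card := by simp
      _ ≤ N := by exact_mod_cast hc
  have hT0 : ∀ x, 0 ≤ T x := fun x => tsum_nonneg fun i => hψ0 i x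
  have hmemΩ : ∀ i x, ψ i x ≠ 0 → dist x (W.center i) < 6 * W.radius i ∧ x ∈ Ω := fun i x h => by
    have h1 : dist x (W.center i) < 6 * W.radius i := by
      by_contra! hcon
      exact h (hψout i x hcon)
    exact ⟨h1, hball6 _ _ h1⟩
  have hTlip : ∀ i x y, dist x (W.center i) < 6 * W.radius i → dist y (W.center i) < 6 * W.radius i →
      |T x - T y| ≤ 2 * N * (dist x y / (3 * (W.radius i / 2))) := by
    intro i x y hxi hyi
    classical
    have hx := hball6 _ _ hxi
    have hy := hball6 _ _ hyi
    obtain ⟨F, hFc, hF⟩ := hfinset x hx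
    obtain ⟨G, hGc, hG⟩ := hfinset y hy
    have e1 : T x = ∑ j ∈ F ∪ G, ψ j x :=
      tsum_eq_sum fun j hj => hF j (fun h => hj (Finset.mem_union_left _ h))
    have e2 : T y = ∑ j ∈ F ∪ G, ψ j y :=
      tsum_eq_sum fun j hj => hG j (fun h => hj (Finset.mem_union_right _ h))
    have hterm : ∀ j, |ψ j x - ψ j y| ≤ dist x y / (3 * (W.radius i / 2)) := fun j => by
      have hdn : 0 ≤ dist x y := dist_nonneg
      have hWi := hWpos i
      have main : ∀ z, dist z (W.center i) < 6 * W.radius i → ψ j z ≠ 0 →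
          W.radius i / 2 ≤ W.radius j := fun z hz hne => by
        have a1 := (hcomp z (W.center i) hz).2
        have a2 := (hcomp z (W.center j) (hmemΩ j z hne).1).1
        have a3 := hWr i
        have a4 := hWr j
        linarith
      have fin : W.radius i / 2 ≤ W.radius j →
          |ψ j x - ψ j y| ≤ dist x y / (3 * (W.radius i / 2)) := fun h =>
        (hψlip j x y).trans (by gcongr)
      by_cases h1 : ψ j x = 0
      · by_cases h2 : ψ j y = 0
        · rw [h1, h2]; simp; positivity
        · exact fin (main y hyi h2)
      · exact fin (main x hxi h1)
    have hWi := hWpos i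
    have hdn : 0 ≤ dist x y := dist_nonneg
    rw [e1, e2, ← Finset.sum_sub_distrib]
    calc |∑ j ∈ F ∪ G, (ψ j x - ψ j y)| ≤ ∑ j ∈ F ∪ G, |ψ j x - ψ j y| :=
          Finset.abs_sum_le_sum_abs _ _
      _ ≤ ∑ j ∈ F ∪ G, dist x y / (3 * (W.radius i / 2)) := Finset.sum_le_sum fun j _ => hterm j
      _ = (F ∪ G).card * (dist x y / (3 * (W.radius i / 2))) := by simp
      _ ≤ _ := by
          gcongr
          have := (Finset.card_union_le F G).trans (add_le_add hFc hGc)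
          calc ((F ∪ G).card : ℝ) ≤ ((N + N : ℕ) : ℝ) := by exact_mod_cast this
            _ = 2 * N := by push_cast; ring
  have hφ1 : ∀ i x, ψ i x / T x ≤ ψ i x := fun i x => by
    by_cases h : ψ i x = 0
    · simp [h]
    · exact div_le_self (hψ0 i x) (hT1 x (hmemΩ i x h).2)
  have hlip1 : ∀ i x y, ψ i x / T x - ψ i y / T y ≤ (1 + 2 * N) / W.radius i * dist x y := by
    intro i x y
    have hWi := hWpos i
    have hdn : 0 ≤ dist x y := dist_nonneg
    have hNN : (0 : ℝ) ≤ N := hN0.le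
    have hq : (1 + 2 * N) / W.radius i * dist x y =
        dist x y / W.radius i + 2 * N * (dist x y / W.radius i) := by ring
    have hq0 : 0 ≤ dist x y / W.radius i := by positivity
    have hq1 : 0 ≤ 2 * N * (dist x y / W.radius i) := by positivity
    have hl : ψ i x - ψ i y ≤ dist x y / W.radius i / 3 := by
      refine (le_abs_self _).trans ((hψlip i x y).trans (le_of_eq ?_))
      field_simp
    rw [hq]
    by_cases hx : ψ i x = 0
    · have : 0 ≤ ψ i y / T y := div_nonneg (hψ0 i y) (hT0 y)
      rw [hx, zero_div]; linarith
    by_cases hy : ψ i y = 0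
    · rw [hy] at hl ⊢
      have := hφ1 i x
      rw [zero_div]; linarith
    obtain ⟨hxi, hxΩ⟩ := hmemΩ i x hx
    obtain ⟨hyi, hyΩ⟩ := hmemΩ i y hy
    have hX1 := hT1 x hxΩ
    have hY1 := hT1 y hyΩ
    have hd := hTlip i x y hxi hyi
    have hd2 : 2 * N * (dist x y / (3 * (W.radius i / 2))) =
        2 / 3 * (2 * N * (dist x y / W.radius i)) := by field_simp
    rw [hd2] at hd
    have hid : ψ i x / T x - ψ i y / T y =
        (ψ i x - ψ i y) / T x + ψ i y / T y * ((T y - T x) / T x) := by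
      have : T x ≠ 0 := by linarith
      have : T y ≠ 0 := by linarith
      field_simp
      ring
    rw [hid]
    have b1 : (ψ i x - ψ i y) / T x ≤ dist x y / W.radius i / 3 :=
      (div_le_div_of_nonneg_right hl (by linarith)).trans (div_le_self (by positivity) hX1)
    have b2 : (T y - T x) / T x ≤ |T x - T y| := by
      rw [abs_sub_comm]
      exact (div_le_div_of_nonneg_right (le_abs_self _) (by linarith)).trans
        (div_le_self (abs_nonneg _) hX1)
    have b3 : ψ i y / T y ≤ 1 := (hφ1 i y).trans (hψ1 i y)
    have b4 : 0 ≤ ψ i y / T y := div_nonneg (hψ0 i y) (hT0 y)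
    have b5 : ψ i y / T y * ((T y - T x) / T x) ≤ 1 * |T x - T y| :=
      (mul_le_mul_of_nonneg_left b2 b4).trans (mul_le_mul_of_nonneg_right b3 (abs_nonneg _))
    linarith
  exact
    { φ := fun i x => ψ i x / T x
      nonneg := fun i x => div_nonneg (hψ0 i x) (hT0 x)
      le_one := fun i x => (hφ1 i x).trans (hψ1 i x)
      eq_zero := fun i x hx => by
        rw [hψout i x (by simpa using hx), zero_div]
      lower_bound := fun i x hx => by
        have h1 := hψin i x (Metric.mem_ball.1 hx).le
        have hxΩ := (hmemΩ i x (by rw [h1]; exact one_ne_zero)).2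
        rw [h1]
        exact one_div_le_one_div_of_le (by linarith [hT1 x hxΩ]) (hTN x hxΩ)
      lipschitz := fun i x y => by
        rw [abs_le]
        have h1 := hlip1 i x y
        have h2 := hlip1 i y x
        rw [dist_comm y x] at h2
        constructor <;> linarith
      hasSum_one := fun x hx => by
        have h := (hsummable x hx).hasSum.div_const (T x)
        rwa [show (∑' i, ψ i x) / T x = 1 from
          div_self (by linarith [hT1 x hx] : T x ≠ 0)] at h }

/-- The discrete fractional convolution `|u|_t^α(x) = ∑_i φ_i(x) r_i ^ α ⨍_{3 B_i} |u| dμ` of `|u|`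
at scale `t`. -/
def discreteFractionalConvolution {X : Type*} [MetricSpace X] [MeasurableSpace X] (μ : Measure X)
    (α : ℝ) {Ω : Set X} {t : ℝ} {N : ℕ} {ν L : ℝ} (W : WhitneyCovering Ω t N)
    (P : WhitneyPartition W ν L) (u : X → ℝ) (x : X) : ℝ≥0∞ :=
  ∑' i, ENNReal.ofReal (P.φ i x) * ENNReal.ofReal (W.radius i ^ α) *
    ⨍⁻ y in Metric.ball (W.center i) (3 * W.radius i), ‖u y‖ₑ ∂μ

/-- The scales: the rational numbers in `(0, 1)`. -/
abbrev Scale : Type := {t : ℚ // 0 < t ∧ t < 1}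

/-- The local discrete fractional maximal function `M*_{α,Ω} u = sup_t |u|_t^α`, the supremum over
all rational scales `t ∈ (0, 1)`, for a choice, at every scale, of a Whitney covering of `Ω` and of
a related partition of unity. -/
def discreteFractionalMaximal {X : Type*} [MetricSpace X] [MeasurableSpace X] (μ : Measure X)
    (α : ℝ) {Ω : Set X} {N : ℕ} {ν L : ℝ} (W : ∀ t : Scale, WhitneyCovering Ω (t.1 : ℝ) N)
    (P : ∀ t : Scale, WhitneyPartition (W t) ν L) (u : X → ℝ) (x : X) : ℝ≥0∞ :=
  ⨆ t : Scale, discreteFractionalConvolution μ α (W t) (P t) u x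

end

/-! The norm estimates rest on a pointwise comparison. If `z` is within `7 r_i` of the centre of
`B_i`, then `3 B_i` lies in `B(z, 10 r_i)`, a ball admissible for the local maximal function at `z`.
So every coefficient `r_i ^ β ⨍_{3 B_i} |u|` is at most `cd ^ 3` times the fractional maximal
function of order `β` at `z`. Since the `φ_i` sum to one, the discrete maximal function is bounded
on `Ω` by `cd ^ 3` times the fractional maximal function of order `α`. The latter is handled by
Hedberg's method: Hölder and the measure lower bound give `r ^ (Q / p) ⨍_B f ≤ C ‖f‖_p`, and
interpolating this with the trivial bound of `⨍_B f` by the Hardy-Littlewood maximal function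
reduces everything to the strong type `(p, p)` estimate, which comes from Vitali covering,
truncation and the layer cake formula.

For the upper gradient, fix a scale `t`. Differences of `φ_i` cost a factor `L / r_i`, which turns
`r_i ^ α` into `r_i ^ (α - 1)`. Hence the increment of the convolution from `x` to `y` is at most
`dist x y` times a constant times the maximal function of order `α - 1` at any `z` close to `x`
(`discreteFractionalConvolution_le_add`). The freedom in `z` allows averaging over short arcs of a
curve, and the arcs add up to a line integral. How short the arcs must be depends on `t`, but the
resulting bound does not, so it passes to the supremum over scales.

This holds along every curve in `Ω`; the upper gradient inequality can then fail only where the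
discrete maximal function is infinite on the whole curve. The norm estimate makes its infinity set
null, and curves inside a null set have zero modulus for every exponent. -/

/-- The fractional maximal function of a nonnegative function `f`, with the radii restricted by the
distance to the complement of `Ω`. -/
noncomputable def fractionalMaximal {X : Type*} [MetricSpace X] [MeasurableSpace X] (μ : Measure X)
    (β : ℝ) (Ω : Set X) (f : X → ℝ≥0∞) (x : X) : ℝ≥0∞ :=
  ⨆ (r : ℝ) (_ : 0 < r) (_ : ENNReal.ofReal r < Metric.infEDist x Ωᶜ),
    ENNReal.ofReal (r ^ β) * ⨍⁻ y in Metric.ball x r, f y ∂μ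

/-! ### Comparison of balls and averages under doubling -/

section Balls

variable {X : Type*} [MetricSpace X] [MeasurableSpace X] {μ : Measure X} {cd : ℝ}

theorem IsDoublingMeasure.measure_ball_two_pow_mul_le (hμ : IsDoublingMeasure μ cd) (n : ℕ) (x : X)
    {r : ℝ} (hr : 0 < r) :
    μ (Metric.ball x (2 ^ n * r)) ≤ ENNReal.ofReal cd ^ n * μ (Metric.ball x r) := by
  induction n with
  | zero => simp
  | succ n ih =>
    calc μ (Metric.ball x (2 ^ (n + 1) * r)) = μ (Metric.ball x (2 * (2 ^ n * r))) := by
          congr 2; ring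
      _ ≤ ENNReal.ofReal cd * μ (Metric.ball x (2 ^ n * r)) := hμ.doubling _ _ (by positivity)
      _ ≤ ENNReal.ofReal cd * (ENNReal.ofReal cd ^ n * μ (Metric.ball x r)) := by gcongr
      _ = _ := by ring

theorem IsDoublingMeasure.measure_ball_ne_zero (hμ : IsDoublingMeasure μ cd) (x : X) {r : ℝ}
    (hr : 0 < r) : μ (Metric.ball x r) ≠ 0 :=
  (hμ.pos_of_isOpen _ Metric.isOpen_ball ⟨x, Metric.mem_ball_self hr⟩).ne'

theorem IsDoublingMeasure.measure_ball_ne_top (hμ : IsDoublingMeasure μ cd) (x : X) (r : ℝ) :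
    μ (Metric.ball x r) ≠ ∞ :=
  (hμ.lt_top_of_isBounded _ Metric.isBounded_ball).ne

theorem IsDoublingMeasure.sigmaFinite (hμ : IsDoublingMeasure μ cd) : SigmaFinite μ := by
  rcases isEmpty_or_nonempty X with hX | ⟨⟨x₀⟩⟩
  · rw [Measure.eq_zero_of_isEmpty μ]
    infer_instance
  · exact ⟨⟨⟨fun n => Metric.ball x₀ n, fun _ => trivial,
      fun n => (hμ.measure_ball_ne_top _ _).lt_top, Metric.iUnion_ball_nat x₀⟩⟩⟩

/-- The small ball lies in the large one, and `n` doublings of the small ball cover the large one,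
so the two measures differ by a factor of at most `cd ^ n`. Measurability of `f` plays no role. -/
theorem IsDoublingMeasure.laverage_ball_le (hμ : IsDoublingMeasure μ cd) (f : X → ℝ≥0∞) {x z : X}
    {s R : ℝ} (hs : 0 < s) (hR : 0 < R) (n : ℕ) (h1 : s + dist x z ≤ R)
    (h2 : R + dist z x ≤ 2 ^ n * s) :
    ⨍⁻ y in Metric.ball x s, f y ∂μ ≤
      ENNReal.ofReal cd ^ n * ⨍⁻ y in Metric.ball z R, f y ∂μ := by
  have hsR : Metric.ball x s ⊆ Metric.ball z R := Metric.ball_subset_ball' h1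
  have hm : μ (Metric.ball z R) ≤ ENNReal.ofReal cd ^ n * μ (Metric.ball x s) :=
    (measure_mono (Metric.ball_subset_ball' h2)).trans (hμ.measure_ball_two_pow_mul_le n x hs)
  have hx0 := hμ.measure_ball_ne_zero x hs
  have hxt := hμ.measure_ball_ne_top x s
  have hz0 := hμ.measure_ball_ne_zero z hR
  have hzt := hμ.measure_ball_ne_top z R
  rw [setLAverage_eq, setLAverage_eq, ENNReal.div_le_iff hx0 hxt]
  calc ∫⁻ y in Metric.ball x s, f y ∂μ ≤ ∫⁻ y in Metric.ball z R, f y ∂μ := lintegral_mono_set hsR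
    _ = (∫⁻ y in Metric.ball z R, f y ∂μ) / μ (Metric.ball z R) * μ (Metric.ball z R) :=
        (ENNReal.div_mul_cancel hz0 hzt).symm
    _ ≤ (∫⁻ y in Metric.ball z R, f y ∂μ) / μ (Metric.ball z R) *
          (ENNReal.ofReal cd ^ n * μ (Metric.ball x s)) := by gcongr
    _ = _ := by ring

theorem le_fractionalMaximal (μ : Measure X) (β : ℝ) {Ω : Set X} (f : X → ℝ≥0∞) {x : X} {r : ℝ}
    (hr : 0 < r) (hrx : ENNReal.ofReal r < Metric.infEDist x Ωᶜ) :
    ENNReal.ofReal (r ^ β) * ⨍⁻ y in Metric.ball x r, f y ∂μ ≤ fractionalMaximal μ β Ω f x :=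
  le_iSup₂_of_le r hr (le_iSup_of_le hrx le_rfl)

theorem ball_subset_of_ofReal_lt_infEDist {X : Type*} [MetricSpace X] {Ω : Set X} {x : X} {r : ℝ}
    (h : ENNReal.ofReal r < Metric.infEDist x Ωᶜ) : Metric.ball x r ⊆ Ω := by
  intro y hy
  by_contra hyΩ
  have h1 : Metric.infEDist x Ωᶜ ≤ edist x y := Metric.infEDist_le_edist_of_mem hyΩ
  have h2 : edist x y ≤ ENNReal.ofReal r := by
    rw [edist_dist]
    exact ENNReal.ofReal_le_ofReal (by rw [dist_comm]; exact (Metric.mem_ball.1 hy).le)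
  exact absurd (h1.trans h2) h.not_ge

/-- Admissible balls lie in `Ω`, so only the values of `f` almost everywhere on `Ω` matter. This
permits passing to a measurable representative of `u`. -/
theorem fractionalMaximal_congr [OpensMeasurableSpace X] (β : ℝ) {Ω : Set X} {f g : X → ℝ≥0∞}
    (h : f =ᵐ[μ.restrict Ω] g) :
    fractionalMaximal μ β Ω f = fractionalMaximal μ β Ω g := by
  ext x
  unfold fractionalMaximal
  refine iSup_congr fun r => iSup_congr fun _ => iSup_congr fun hr => ?_
  rw [setLAverage_eq, setLAverage_eq]
  congr 2
  exact lintegral_congr_ae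
    (ae_restrict_of_ae_restrict_of_subset (ball_subset_of_ofReal_lt_infEDist hr) h)

theorem lt_fractionalMaximal_zero_iff {Ω : Set X} {f : X → ℝ≥0∞} {x : X} {c : ℝ≥0∞} :
    c < fractionalMaximal μ 0 Ω f x ↔ ∃ r : ℝ, 0 < r ∧ ENNReal.ofReal r < Metric.infEDist x Ωᶜ ∧
      c < ⨍⁻ y in Metric.ball x r, f y ∂μ := by
  simp only [fractionalMaximal, lt_iSup_iff, Real.rpow_zero, ENNReal.ofReal_one, one_mul,
    exists_prop]

end Balls

/-! ### Measurability of the fractional maximal function -/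

section Measurability

/-- An open ball is exhausted by smaller concentric balls, and each of these remains inside the ball
of radius `r` when the centre of the latter moves a little. -/
theorem lowerSemicontinuous_measure_ball {X : Type*} [MetricSpace X] [MeasurableSpace X]
    (ν : Measure X) (r : ℝ) :
    LowerSemicontinuous fun x => ν (Metric.ball x r) := by
  intro x c hc
  obtain ⟨u, hu, hur, hlim⟩ := exists_seq_strictMono_tendsto r
  have hun : Metric.ball x r = ⋃ n, Metric.ball x (u n) := by
    ext y
    simp only [Metric.mem_ball, mem_iUnion]
    exact ⟨fun hy => (hlim.eventually (lt_mem_nhds hy)).exists, fun ⟨n, hn⟩ => hn.trans (hur n)⟩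
  have hmono : Monotone fun n => Metric.ball x (u n) :=
    fun m n hmn => Metric.ball_subset_ball (hu.monotone hmn)
  have ht := tendsto_measure_iUnion_atTop (μ := ν) hmono
  rw [← hun] at ht
  obtain ⟨n, hn⟩ := (ht.eventually (lt_mem_nhds hc)).exists
  filter_upwards [Metric.ball_mem_nhds x (sub_pos.2 (hur n))] with y hy
  refine lt_of_lt_of_le hn (measure_mono (Metric.ball_subset_ball' ?_))
  rw [dist_comm]
  linarith [Metric.mem_ball.1 hy]

variable {X : Type*} [MetricSpace X] [MeasurableSpace X] [BorelSpace X]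

theorem measurable_laverage_ball (μ : Measure X) (f : X → ℝ≥0∞) (r : ℝ) :
    Measurable fun x => ⨍⁻ y in Metric.ball x r, f y ∂μ := by
  have h : ∀ x, ⨍⁻ y in Metric.ball x r, f y ∂μ =
      μ.withDensity f (Metric.ball x r) / μ (Metric.ball x r) := fun x => by
    rw [setLAverage_eq, withDensity_apply _ Metric.isOpen_ball.measurableSet]
  simp_rw [h]
  exact (lowerSemicontinuous_measure_ball _ r).measurable.div
    (lowerSemicontinuous_measure_ball _ r).measurable

/-- Reduces the supremum to countably many radii. As rationals `q` increase to `r`, the integrals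
over the balls converge, while replacing `μ(B(x, q))` by the larger `μ(B(x, r))` only weakens the
bound. Taking `q < r` keeps the radii admissible. -/
theorem IsDoublingMeasure.mul_laverage_ball_le_iSup_rat {μ : Measure X} {cd : ℝ}
    (hμ : IsDoublingMeasure μ cd) (β : ℝ) (f : X → ℝ≥0∞) (x : X) {r : ℝ} (hr : 0 < r) :
    ENNReal.ofReal (r ^ β) * ⨍⁻ y in Metric.ball x r, f y ∂μ ≤
      ⨆ (q : ℚ) (_ : (0 : ℝ) < q) (_ : (q : ℝ) < r),
        ENNReal.ofReal ((q : ℝ) ^ β) * ⨍⁻ y in Metric.ball x (q : ℝ), f y ∂μ := by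
  obtain ⟨u, hu, hur, hlim⟩ :=
    (Rat.denseRange_cast (𝕜 := ℝ)).exists_seq_strictMono_tendsto Rat.cast_mono r
  have hun : Metric.ball x r = ⋃ n, Metric.ball x (u n : ℝ) := by
    ext y
    simp only [Metric.mem_ball, mem_iUnion]
    exact ⟨fun hy => (hlim.eventually (lt_mem_nhds hy)).exists, fun ⟨n, hn⟩ => hn.trans (hur n)⟩
  have hmono : Monotone fun n => Metric.ball x (u n : ℝ) :=
    fun m n hmn => Metric.ball_subset_ball (by exact_mod_cast hu.monotone hmn)
  have ht := tendsto_measure_iUnion_atTop (μ := μ.withDensity f) hmono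
  rw [← hun] at ht
  have h1 : Filter.Tendsto (fun n => ENNReal.ofReal ((u n : ℝ) ^ β)) Filter.atTop
      (nhds (ENNReal.ofReal (r ^ β))) :=
    ENNReal.tendsto_ofReal ((Real.continuousAt_rpow_const r β (Or.inl hr.ne')).tendsto.comp hlim)
  have h0 : ENNReal.ofReal (r ^ β) ≠ 0 := by
    rw [Ne, ENNReal.ofReal_eq_zero, not_le]
    positivity
  have h2 := ENNReal.Tendsto.mul h1 (Or.inl h0) ht (Or.inr ENNReal.ofReal_ne_top)
  have hx0 := hμ.measure_ball_ne_zero x hr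
  have hxt := hμ.measure_ball_ne_top x r
  rw [setLAverage_eq, ← mul_div_assoc, ENNReal.div_le_iff hx0 hxt,
    ← withDensity_apply _ Metric.isOpen_ball.measurableSet]
  refine le_of_tendsto h2 ?_
  filter_upwards [hlim.eventually (lt_mem_nhds hr)] with n hn
  have hn' : (0 : ℝ) < u n := hn
  have hy0 := hμ.measure_ball_ne_zero x hn'
  have hyt := hμ.measure_ball_ne_top x (u n : ℝ)
  calc ENNReal.ofReal ((u n : ℝ) ^ β) * μ.withDensity f (Metric.ball x (u n : ℝ))
      = (ENNReal.ofReal ((u n : ℝ) ^ β) * ⨍⁻ y in Metric.ball x (u n : ℝ), f y ∂μ) *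
          μ (Metric.ball x (u n : ℝ)) := by
        rw [setLAverage_eq, withDensity_apply _ Metric.isOpen_ball.measurableSet, mul_assoc,
          ENNReal.div_mul_cancel hy0 hyt]
    _ ≤ _ := by
        gcongr
        · exact le_iSup₂_of_le (u n) hn' (le_iSup_of_le (hur n) le_rfl)
        · exact (hur n).le

theorem IsDoublingMeasure.measurable_fractionalMaximal {μ : Measure X} {cd : ℝ}
    (hμ : IsDoublingMeasure μ cd) (β : ℝ) (Ω : Set X) (f : X → ℝ≥0∞) :
    Measurable (fractionalMaximal μ β Ω f) := by
  classical
  -- The range of radii depends on `x`; moving this restriction into an indicator leaves a supremum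
  -- over a fixed countable family of measurable functions.
  have h : fractionalMaximal μ β Ω f = fun x => ⨆ (q : ℚ) (_ : (0 : ℝ) < q),
      {x | ENNReal.ofReal (q : ℝ) < Metric.infEDist x Ωᶜ}.indicator
        (fun x => ENNReal.ofReal ((q : ℝ) ^ β) * ⨍⁻ y in Metric.ball x (q : ℝ), f y ∂μ) x := by
    ext x
    refine le_antisymm (iSup₂_le fun r hr => iSup_le fun hrx => ?_) (iSup₂_le fun q hq => ?_)
    · refine (hμ.mul_laverage_ball_le_iSup_rat β f x hr).trans
        (iSup₂_mono fun q hq => iSup_le fun hqr => ?_)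
      rw [indicator_of_mem]
      exact (ENNReal.ofReal_le_ofReal hqr.le).trans_lt hrx
    · by_cases hx : ENNReal.ofReal (q : ℝ) < Metric.infEDist x Ωᶜ
      · rw [indicator_of_mem (by exact hx)]
        exact le_fractionalMaximal μ β f hq hx
      · rw [indicator_of_notMem (by exact hx)]
        exact zero_le
  rw [h]
  refine Measurable.iSup fun q => Measurable.iSup fun _ =>
    ((measurable_laverage_ball μ f q).const_mul _).indicator ?_
  exact measurableSet_lt measurable_const measurable_infEDist

end Measurability

/-! ### The Hardy-Littlewood maximal theorem -/

section StrongType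

variable {X : Type*} [MetricSpace X] [MeasurableSpace X] [BorelSpace X] {μ : Measure X}
  {cd cl Q : ℝ}

/-- The weak type `(1, 1)` estimate for the Hardy-Littlewood maximal function. -/
theorem IsDoublingMeasure.meas_lt_fractionalMaximal_zero_le (hμ : IsDoublingMeasure μ cd)
    (hl : MeasureLowerBound μ cl Q) (hcl : 0 < cl) (hQ : 0 < Q) (Ω : Set X) (f : X → ℝ≥0∞)
    {t : ℝ} (ht : 0 < t) :
    μ {x | ENNReal.ofReal t < fractionalMaximal μ 0 Ω f x} ≤
      ENNReal.ofReal cd ^ 2 * ((∫⁻ x, f x ∂μ) / ENNReal.ofReal t) := by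
  have := hμ.sigmaFinite
  have ht0 : ENNReal.ofReal t ≠ 0 := by simpa using ht
  set E := {x | ENNReal.ofReal t < fractionalMaximal μ 0 Ω f x} with hE
  rcases E.eq_empty_or_nonempty with hEe | ⟨x₀, hx₀⟩
  · rw [hEe]; simp
  -- Needed when `f` has infinite integral: the right side is then infinite only because its
  -- constant is nonzero.
  have hcd : ENNReal.ofReal cd ≠ 0 := fun h0 => by
    have := hμ.doubling x₀ 1 one_pos
    rw [h0, zero_mul, nonpos_iff_eq_zero] at this
    exact hμ.measure_ball_ne_zero x₀ (by norm_num) this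
  by_cases hI : ∫⁻ x, f x ∂μ = ∞
  · rw [hI, ENNReal.top_div_of_ne_top ENNReal.ofReal_ne_top, ENNReal.mul_top (pow_ne_zero _ hcd)]
    exact le_top
  have hex : ∀ x, ∃ r : ℝ, x ∈ E → 0 < r ∧
      ENNReal.ofReal t * μ (Metric.ball x r) ≤ ∫⁻ y in Metric.ball x r, f y ∂μ := fun x => by
    by_cases hx : x ∈ E
    · obtain ⟨r, hr, -, h⟩ := lt_fractionalMaximal_zero_iff.1 hx
      refine ⟨r, fun _ => ⟨hr, ?_⟩⟩
      rw [setLAverage_eq] at h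
      exact (ENNReal.le_div_iff_mul_le (Or.inl (hμ.measure_ball_ne_zero x hr))
        (Or.inl (hμ.measure_ball_ne_top x r))).1 h.le
    · exact ⟨0, fun h => absurd h hx⟩
  choose r hr using hex
  set J := (∫⁻ x, f x ∂μ).toReal with hJ
  -- Vitali's covering lemma needs bounded radii. The measure lower bound supplies this, since `t *
  -- cl * r ^ Q` is at most the integral of `f`.
  have hR : ∀ x ∈ E, r x ≤ (J / (t * cl)) ^ (Q⁻¹) := fun x hx => by
    obtain ⟨h0, h1⟩ := hr x hx
    have h2 : ENNReal.ofReal (t * (cl * r x ^ Q)) ≤ ENNReal.ofReal J := by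
      rw [hJ, ENNReal.ofReal_toReal hI, ENNReal.ofReal_mul ht.le]
      calc _ ≤ ENNReal.ofReal t * μ (Metric.ball x (r x)) := by gcongr; exact hl x _ h0
        _ ≤ _ := h1.trans (setLIntegral_le_lintegral _ _)
    have hJ0 : 0 ≤ J := ENNReal.toReal_nonneg
    rw [ENNReal.ofReal_le_ofReal_iff hJ0] at h2
    rw [Real.le_rpow_inv_iff_of_pos h0.le (by positivity) hQ, le_div_iff₀ (by positivity)]
    linarith
  -- Any enlargement factor above 3 is allowed; `2 ^ 2` costs exactly two doublings.
  obtain ⟨u, huE, hudisj, hucov⟩ :=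
    Vitali.exists_disjoint_subfamily_covering_enlargement_ball E id r _ hR (2 ^ 2) (by norm_num)
  have hucount : u.Countable := by
    have h := Measure.countable_meas_pos_of_disjoint_iUnion (μ := μ)
      (As := fun x : u => Metric.ball (x : X) (r x))
      (fun _ => Metric.isOpen_ball.measurableSet)
      (fun x y hxy => hudisj x.2 y.2 (fun h => hxy (Subtype.ext h)))
    have huniv : {i : u | 0 < μ (Metric.ball (i : X) (r i))} = univ := by
      ext i
      simp only [mem_ofPred_eq, mem_univ, iff_true]
      exact pos_iff_ne_zero.2 (hμ.measure_ball_ne_zero _ (hr i (huE i.2)).1)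
    rw [huniv] at h
    exact Set.countable_coe_iff.1 (Set.countable_univ_iff.1 h)
  have : Countable u := hucount.to_subtype
  have hEsub : E ⊆ ⋃ i : u, Metric.ball (i : X) (2 ^ 2 * r i) := fun x hx => by
    obtain ⟨b, hb, hsub⟩ := hucov x hx
    exact mem_iUnion.2 ⟨⟨b, hb⟩, hsub (Metric.mem_ball_self (hr x hx).1)⟩
  calc μ E ≤ ∑' i : u, μ (Metric.ball (i : X) (2 ^ 2 * r i)) :=
        (measure_mono hEsub).trans (measure_iUnion_le _)
    _ ≤ ∑' i : u, ENNReal.ofReal cd ^ 2 * ((∫⁻ y in Metric.ball (i : X) (r i), f y ∂μ) /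
          ENNReal.ofReal t) := by
        refine ENNReal.tsum_le_tsum fun i => ?_
        obtain ⟨h0, h1⟩ := hr i (huE i.2)
        refine (hμ.measure_ball_two_pow_mul_le 2 i h0).trans ?_
        gcongr
        rw [ENNReal.le_div_iff_mul_le (Or.inl ht0) (Or.inl ENNReal.ofReal_ne_top), mul_comm]
        exact h1
    _ = ENNReal.ofReal cd ^ 2 * ((∫⁻ y in ⋃ i ∈ u, Metric.ball i (r i), f y ∂μ) /
          ENNReal.ofReal t) := by
        rw [ENNReal.tsum_mul_left]
        congr 1
        rw [lintegral_biUnion (s := fun i => Metric.ball i (r i)) hucount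
          (fun _ _ => Metric.isOpen_ball.measurableSet) hudisj]
        simp_rw [div_eq_mul_inv]
        rw [ENNReal.tsum_mul_right]
    _ ≤ _ := by gcongr; exact Measure.restrict_le_self

/-- Truncation: the part of `f` with `2 * f ≤ t` contributes at most `t / 2` to any average, so the
rest must have maximal function above `t / 2`. The weak type estimate is applied to the rest. -/
theorem IsDoublingMeasure.meas_lt_fractionalMaximal_zero_le_setLIntegral
    (hμ : IsDoublingMeasure μ cd) (hl : MeasureLowerBound μ cl Q) (hcl : 0 < cl) (hQ : 0 < Q)
    (Ω : Set X) {f : X → ℝ≥0∞} (hf : Measurable f) {t : ℝ} (ht : 0 < t) :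
    μ {x | ENNReal.ofReal t < fractionalMaximal μ 0 Ω f x} ≤
      ENNReal.ofReal cd ^ 2 * ((∫⁻ x in {x | ENNReal.ofReal t < 2 * f x}, f x ∂μ) /
        ENNReal.ofReal (t / 2)) := by
  have hS : MeasurableSet {x | ENNReal.ofReal t < 2 * f x} :=
    measurableSet_lt measurable_const (hf.const_mul 2)
  rw [← lintegral_indicator hS]
  refine le_trans (measure_mono fun x hx => ?_)
    (hμ.meas_lt_fractionalMaximal_zero_le hl hcl hQ Ω _ (half_pos ht))
  obtain ⟨r, hr, hrx, h⟩ := lt_fractionalMaximal_zero_iff.1 hx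
  refine lt_fractionalMaximal_zero_iff.2 ⟨r, hr, hrx, ?_⟩
  have h0 := hμ.measure_ball_ne_zero x hr
  have htop := hμ.measure_ball_ne_top x r
  have key : ⨍⁻ y in Metric.ball x r, f y ∂μ ≤
      ⨍⁻ y in Metric.ball x r, {x | ENNReal.ofReal t < 2 * f x}.indicator f y ∂μ +
        ENNReal.ofReal (t / 2) := by
    rw [setLAverage_eq, setLAverage_eq, ENNReal.div_le_iff h0 htop, add_mul,
      ENNReal.div_mul_cancel h0 htop, ← setLIntegral_const, ← lintegral_add_right _ measurable_const]
    refine lintegral_mono fun y => ?_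
    by_cases hy : ENNReal.ofReal t < 2 * f y
    · rw [indicator_of_mem (by exact hy)]
      exact le_self_add
    · rw [indicator_of_notMem (by exact hy), zero_add, ENNReal.ofReal_div_of_pos two_pos,
        ENNReal.le_div_iff_mul_le (by simp) (by simp), mul_comm]
      simpa using hy
  have h1 : ENNReal.ofReal t = ENNReal.ofReal (t / 2) + ENNReal.ofReal (t / 2) := by
    rw [← ENNReal.ofReal_add (by positivity) (by positivity), add_halves]
  refine (ENNReal.add_lt_add_iff_right (ENNReal.ofReal_ne_top (r := t / 2))).1 ?_
  rw [← h1]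
  exact h.trans_le key

/-- The layer cake formula for functions with values in `[0, ∞]`. -/
theorem lintegral_ennreal_rpow_eq_lintegral_meas_lt_mul {α : Type*} [MeasurableSpace α]
    (μ : Measure α) {g : α → ℝ≥0∞} (hg : Measurable g) {q : ℝ} (hq : 0 < q) :
    ∫⁻ x, g x ^ q ∂μ = ENNReal.ofReal q *
      ∫⁻ t in Ioi (0 : ℝ), μ {x | ENNReal.ofReal t < g x} * ENNReal.ofReal (t ^ (q - 1)) := by
  -- If `g` is almost everywhere finite, the real-valued formula applies to `toReal`; otherwise both
  -- sides are infinite.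
  by_cases htop : μ {x | g x = ∞} = 0
  · have hfin : ∀ᵐ x ∂μ, g x ≠ ∞ := by rwa [ae_iff, show {x | ¬ g x ≠ ∞} = {x | g x = ∞} by simp]
    have h := lintegral_rpow_eq_lintegral_meas_lt_mul μ (f := fun x => (g x).toReal)
      (Filter.Eventually.of_forall fun x => ENNReal.toReal_nonneg) hg.ennreal_toReal.aemeasurable hq
    rw [lintegral_congr_ae (g := fun x => ENNReal.ofReal ((g x).toReal ^ q)), h]
    · congr 1
      refine setLIntegral_congr_fun measurableSet_Ioi fun t ht => ?_
      congr 1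
      refine measure_congr ?_
      filter_upwards [hfin] with x hx
      refine propext ?_
      exact (ENNReal.ofReal_lt_iff_lt_toReal (le_of_lt ht) hx).symm
    · filter_upwards [hfin] with x hx
      rw [← ENNReal.ofReal_rpow_of_nonneg ENNReal.toReal_nonneg hq.le, ENNReal.ofReal_toReal hx]
  · have hL : ∫⁻ x, g x ^ q ∂μ = ∞ := by
      by_contra hne
      refine htop ?_
      have := ae_lt_top (hg.pow_const q) hne
      rw [ae_iff] at this
      refine measure_mono_null (fun x hx => ?_) this
      have hx' : g x = ∞ := hx
      simp [hx', hq]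
    -- No power of `t` is integrable over the whole half-line, and every superlevel set contains `{g
    -- = ∞}`.
    have hR : ∫⁻ t in Ioi (0 : ℝ), ENNReal.ofReal (t ^ (q - 1)) = ∞ := by
      by_contra hne
      refine not_integrableOn_Ioi_rpow (q - 1) ⟨by fun_prop, ?_⟩
      rw [hasFiniteIntegral_iff_ofReal]
      · exact lt_top_iff_ne_top.2 hne
      · filter_upwards [ae_restrict_mem measurableSet_Ioi] with t ht
        exact Real.rpow_nonneg (le_of_lt ht) _
    rw [hL, eq_comm, eq_top_iff]
    have hR' : ENNReal.ofReal q * (μ {x | g x = ∞} *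
        ∫⁻ t in Ioi (0 : ℝ), ENNReal.ofReal (t ^ (q - 1))) = ∞ := by
      rw [hR, ENNReal.mul_top htop, ENNReal.mul_top (by simpa using hq)]
    rw [← hR']
    gcongr
    rw [← lintegral_const_mul _ (by fun_prop)]
    gcongr with t x
    intro hx
    simp [hx]

/-- The constant in the strong type `(p, p)` estimate for the Hardy-Littlewood maximal function. -/
noncomputable def maximalConstant (cd p : ℝ) : ℝ≥0∞ :=
  ENNReal.ofReal p * (ENNReal.ofReal cd ^ 2 * 2 * (2 ^ (p - 1) / ENNReal.ofReal (p - 1)))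

theorem maximalConstant_ne_top (cd : ℝ) {p : ℝ} (hp : 1 < p) : maximalConstant cd p ≠ ∞ := by
  unfold maximalConstant
  have h1 : ENNReal.ofReal (p - 1) ≠ 0 := by simpa using hp
  have h2 : (2 : ℝ≥0∞) ^ (p - 1) ≠ ∞ := ENNReal.rpow_ne_top_of_nonneg (by linarith) (by simp)
  finiteness

/-- The strong type `(p, p)` estimate for the Hardy-Littlewood maximal function. -/
theorem IsDoublingMeasure.lintegral_fractionalMaximal_zero_rpow_le (hμ : IsDoublingMeasure μ cd)
    (hl : MeasureLowerBound μ cl Q) (hcl : 0 < cl) (hQ : 0 < Q) (Ω : Set X) {f : X → ℝ≥0∞}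
    (hf : Measurable f) {p : ℝ} (hp : 1 < p) :
    ∫⁻ x, fractionalMaximal μ 0 Ω f x ^ p ∂μ ≤ maximalConstant cd p * ∫⁻ x, f x ^ p ∂μ := by
  have hp1 : ENNReal.ofReal (p - 1) ≠ 0 := by simpa using hp
  have h2f : Measurable fun x => 2 * f x := hf.const_mul 2
  have hS : ∀ t : ℝ, MeasurableSet {x | ENNReal.ofReal t < 2 * f x} := fun t =>
    measurableSet_lt measurable_const h2f
  rw [lintegral_ennreal_rpow_eq_lintegral_meas_lt_mul μ
    (hμ.measurable_fractionalMaximal 0 Ω f) (by linarith : 0 < p)]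
  -- A second layer cake, for `2 * f` with exponent `p - 1` and the measure `f dμ`: its distribution
  -- function is precisely the truncated integral in the weak type estimate, so no separate Fubini
  -- argument is needed.
  have hcake := lintegral_ennreal_rpow_eq_lintegral_meas_lt_mul (μ.withDensity f) h2f
    (by linarith : 0 < p - 1)
  have hlhs : ∫⁻ x, (2 * f x) ^ (p - 1) ∂(μ.withDensity f) =
      2 ^ (p - 1) * ∫⁻ x, f x ^ p ∂μ := by
    rw [lintegral_withDensity_eq_lintegral_mul _ hf (h2f.pow_const _),
      ← lintegral_const_mul _ (hf.pow_const _)]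
    refine lintegral_congr fun x => ?_
    simp only [Pi.mul_apply]
    rw [ENNReal.mul_rpow_of_nonneg _ _ (by linarith), mul_left_comm]
    congr 1
    conv_rhs => rw [show p = 1 + (p - 1) by ring,
      ENNReal.rpow_add_of_nonneg _ _ zero_le_one (by linarith), ENNReal.rpow_one]
  rw [hlhs] at hcake
  have hdiv : ∫⁻ t in Ioi (0 : ℝ), μ.withDensity f {x | ENNReal.ofReal t < 2 * f x} *
      ENNReal.ofReal (t ^ (p - 1 - 1)) =
      2 ^ (p - 1) / ENNReal.ofReal (p - 1) * ∫⁻ x, f x ^ p ∂μ := by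
    rw [div_eq_mul_inv, mul_right_comm, hcake, mul_right_comm,
      ENNReal.mul_inv_cancel hp1 ENNReal.ofReal_ne_top, one_mul]
  have hcC : ENNReal.ofReal cd ^ 2 * 2 ≠ ∞ := by finiteness
  unfold maximalConstant
  rw [mul_assoc, mul_assoc (ENNReal.ofReal cd ^ 2 * 2), ← hdiv, ← lintegral_const_mul' _ _ hcC]
  refine mul_le_mul_right (lintegral_mono_ae ?_) _
  filter_upwards [ae_restrict_mem measurableSet_Ioi] with t ht
  have ht0 : (0 : ℝ) < t := ht
  -- One power of `t` is split off to cancel the denominator `t / 2`, leaving the factor 2 in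
  -- `maximalConstant`.
  have htt : ENNReal.ofReal (t ^ (p - 1)) = ENNReal.ofReal t * ENNReal.ofReal (t ^ (p - 1 - 1)) := by
    rw [← ENNReal.ofReal_mul ht0.le, Real.rpow_sub_one ht0.ne' (p - 1)]
    congr 1
    field_simp
  have hinv : (ENNReal.ofReal (t / 2))⁻¹ * ENNReal.ofReal t = 2 := by
    rw [mul_comm, ← div_eq_mul_inv, ← ENNReal.ofReal_div_of_pos (by positivity)]
    rw [show t / (t / 2) = 2 by field_simp]
    simp
  calc μ {x | ENNReal.ofReal t < fractionalMaximal μ 0 Ω f x} * ENNReal.ofReal (t ^ (p - 1))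
      ≤ ENNReal.ofReal cd ^ 2 * ((∫⁻ x in {x | ENNReal.ofReal t < 2 * f x}, f x ∂μ) /
        ENNReal.ofReal (t / 2)) * ENNReal.ofReal (t ^ (p - 1)) := by
        gcongr
        exact hμ.meas_lt_fractionalMaximal_zero_le_setLIntegral hl hcl hQ Ω hf ht0
    _ = ENNReal.ofReal cd ^ 2 * ((∫⁻ x in {x | ENNReal.ofReal t < 2 * f x}, f x ∂μ) *
        ((ENNReal.ofReal (t / 2))⁻¹ * ENNReal.ofReal t) * ENNReal.ofReal (t ^ (p - 1 - 1))) := by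
        rw [htt, div_eq_mul_inv]; ring
    _ = _ := by rw [hinv, withDensity_apply _ (hS t)]; ring

end StrongType

/-! ### Hedberg's inequality and the Sobolev type estimate -/

section FractionalMaximal

variable {X : Type*} [MetricSpace X] [MeasurableSpace X] {μ : Measure X}
  {cd cl Q : ℝ}

/-- Hölder bounds the average by `‖f‖_p μ(B) ^ (-1 / p)`, and the lower bound on `μ(B)` turns this
into a power of the radius. -/
theorem IsDoublingMeasure.rpow_mul_laverage_ball_le (hμ : IsDoublingMeasure μ cd)
    (hl : MeasureLowerBound μ cl Q) (hcl : 0 < cl) {f : X → ℝ≥0∞} (hf : Measurable f) {p : ℝ}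
    (hp : 1 < p) (x : X) {r : ℝ} (hr : 0 < r) :
    ENNReal.ofReal (r ^ (Q / p)) * ⨍⁻ y in Metric.ball x r, f y ∂μ ≤
      ((∫⁻ y, f y ^ p ∂μ) / ENNReal.ofReal cl) ^ (1 / p) := by
  have hp0 : 0 < p := by linarith
  set B := Metric.ball x r with hB
  have hcl0 : ENNReal.ofReal cl ≠ 0 := by simpa using hcl
  have hpq : p.HolderConjugate (Real.conjExponent p) := Real.HolderConjugate.conjExponent hp
  have hH : ∫⁻ y in B, f y ∂μ ≤
      (∫⁻ y, f y ^ p ∂μ) ^ (1 / p) * μ B ^ (1 / Real.conjExponent p) := by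
    have h := ENNReal.lintegral_mul_le_Lp_mul_Lq (μ.restrict B) hpq hf.aemeasurable
      (measurable_const (a := (1 : ℝ≥0∞))).aemeasurable
    simp only [Pi.mul_apply, mul_one, ENNReal.one_rpow, lintegral_const, one_mul,
      Measure.restrict_apply_univ] at h
    refine h.trans ?_
    gcongr
    exact Measure.restrict_le_self
  have hR : ENNReal.ofReal (r ^ (Q / p)) ≤ (μ B / ENNReal.ofReal cl) ^ (1 / p) := by
    have h1 : ENNReal.ofReal (r ^ Q) ≤ μ B / ENNReal.ofReal cl := by
      rw [ENNReal.le_div_iff_mul_le (Or.inl hcl0) (Or.inl ENNReal.ofReal_ne_top), mul_comm,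
        ← ENNReal.ofReal_mul hcl.le]
      exact hl x r hr
    have h2 : ENNReal.ofReal (r ^ (Q / p)) = ENNReal.ofReal (r ^ Q) ^ (1 / p) := by
      rw [ENNReal.ofReal_rpow_of_pos (by positivity), ← Real.rpow_mul hr.le, mul_one_div]
    rw [h2]
    gcongr
  rw [setLAverage_eq, ← mul_div_assoc,
    ENNReal.div_le_iff (hμ.measure_ball_ne_zero x hr) (hμ.measure_ball_ne_top x r)]
  have hsum : 1 / p + 1 / Real.conjExponent p = 1 := by
    simpa [one_div] using hpq.inv_add_inv_eq_one
  calc ENNReal.ofReal (r ^ (Q / p)) * ∫⁻ y in B, f y ∂μ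
      ≤ (μ B / ENNReal.ofReal cl) ^ (1 / p) *
        ((∫⁻ y, f y ^ p ∂μ) ^ (1 / p) * μ B ^ (1 / Real.conjExponent p)) := by gcongr
    _ = ((∫⁻ y, f y ^ p ∂μ) / ENNReal.ofReal cl) ^ (1 / p) *
        (μ B ^ (1 / p) * μ B ^ (1 / Real.conjExponent p)) := by
        simp only [div_eq_mul_inv _ (ENNReal.ofReal cl)]
        rw [ENNReal.mul_rpow_of_nonneg _ _ (by positivity),
          ENNReal.mul_rpow_of_nonneg _ _ (by positivity)]
        ring
    _ = _ := by
        rw [← ENNReal.rpow_add_of_nonneg _ _ (by positivity) (one_div_nonneg.2 hpq.symm.nonneg),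
          hsum, ENNReal.rpow_one]

/-- Hedberg's pointwise inequality. -/
theorem IsDoublingMeasure.fractionalMaximal_le_mul_rpow (hμ : IsDoublingMeasure μ cd)
    (hl : MeasureLowerBound μ cl Q) (hcl : 0 < cl) (hQ : 0 < Q) (Ω : Set X) {f : X → ℝ≥0∞}
    (hf : Measurable f) {p β : ℝ} (hp : 1 < p) (hβ : 0 ≤ β) (hβQ : β < Q / p) (x : X) :
    fractionalMaximal μ β Ω f x ≤
      ((∫⁻ y, f y ^ p ∂μ) / ENNReal.ofReal cl) ^ (β / Q) *
        fractionalMaximal μ 0 Ω f x ^ (1 - β * p / Q) := by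
  have hp0 : 0 < p := by linarith
  have hθ0 : 0 ≤ β * p / Q := by positivity
  have hθ1 : 0 ≤ 1 - β * p / Q := by
    rw [sub_nonneg, div_le_one hQ]
    exact ((lt_div_iff₀ hp0).1 hβQ).le
  refine iSup₂_le fun r hr => iSup_le fun hrx => ?_
  set A := ⨍⁻ y in Metric.ball x r, f y ∂μ with hA
  have h1 : A ≤ fractionalMaximal μ 0 Ω f x := by
    simpa using le_fractionalMaximal μ 0 f hr hrx
  have h2 := hμ.rpow_mul_laverage_ball_le hl hcl hf hp x hr
  -- With `θ = β p / Q`, the quantity `r ^ β A` is `(r ^ (Q / p) A) ^ θ * A ^ (1 - θ)`; the first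
  -- factor is bounded uniformly in `r`, the second by the maximal function of order zero.
  have h3 : ENNReal.ofReal (r ^ β) = ENNReal.ofReal (r ^ (Q / p)) ^ (β * p / Q) := by
    rw [ENNReal.ofReal_rpow_of_pos (by positivity), ← Real.rpow_mul hr.le]
    congr 2
    field_simp
  calc ENNReal.ofReal (r ^ β) * A
      = (ENNReal.ofReal (r ^ (Q / p)) * A) ^ (β * p / Q) * A ^ (1 - β * p / Q) := by
        rw [ENNReal.mul_rpow_of_nonneg _ _ hθ0, mul_assoc, ← ENNReal.rpow_add_of_nonneg _ _ hθ0 hθ1,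
          add_sub_cancel, ENNReal.rpow_one, h3]
    _ ≤ (((∫⁻ y, f y ^ p ∂μ) / ENNReal.ofReal cl) ^ (1 / p)) ^ (β * p / Q) *
        fractionalMaximal μ 0 Ω f x ^ (1 - β * p / Q) := by gcongr
    _ = _ := by
        rw [← ENNReal.rpow_mul]
        congr 2
        field_simp

variable [BorelSpace X]

/-- The constant in the Sobolev type estimate for the fractional maximal function. -/
noncomputable def fractionalMaximalConstant (cd cl Q p β : ℝ) : ℝ≥0∞ :=
  (ENNReal.ofReal cl)⁻¹ ^ (β / Q) * maximalConstant cd p ^ (1 / (Q * p / (Q - β * p)))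

theorem fractionalMaximalConstant_ne_top (cd : ℝ) {cl Q p β : ℝ} (hcl : 0 < cl) (hp : 1 < p)
    (hQ : 0 < Q) (hβ : 0 ≤ β) (hβQ : β < Q / p) :
    fractionalMaximalConstant cd cl Q p β ≠ ∞ := by
  have hp0 : 0 < p := by linarith
  have h : 0 < Q - β * p := sub_pos.2 ((lt_div_iff₀ hp0).1 hβQ)
  refine ENNReal.mul_ne_top (ENNReal.rpow_ne_top_of_nonneg (by positivity) ?_)
    (ENNReal.rpow_ne_top_of_nonneg (by positivity) (maximalConstant_ne_top cd hp))
  simpa using hcl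

/-- The fractional maximal function maps `L ^ p` to `L ^ (Q p / (Q - β p))`. -/
theorem IsDoublingMeasure.eLpNorm_fractionalMaximal_le (hμ : IsDoublingMeasure μ cd)
    (hl : MeasureLowerBound μ cl Q) (hcl : 0 < cl) (hQ : 0 < Q) (Ω : Set X) {f : X → ℝ≥0∞}
    (hf : Measurable f) {p β : ℝ} (hp : 1 < p) (hβ : 0 ≤ β) (hβQ : β < Q / p) :
    eLpNorm (fractionalMaximal μ β Ω f) (ENNReal.ofReal (Q * p / (Q - β * p))) μ ≤
      fractionalMaximalConstant cd cl Q p β * eLpNorm f (ENNReal.ofReal p) μ := by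
  have hp0 : 0 < p := by linarith
  have hd : 0 < Q - β * p := sub_pos.2 ((lt_div_iff₀ hp0).1 hβQ)
  have hq0 : 0 < Q * p / (Q - β * p) := by positivity
  rw [eLpNorm_eq_lintegral_rpow_enorm_toReal (by simpa using hq0) ENNReal.ofReal_ne_top,
    eLpNorm_eq_lintegral_rpow_enorm_toReal (by simpa using hp0) ENNReal.ofReal_ne_top,
    ENNReal.toReal_ofReal hq0.le, ENNReal.toReal_ofReal hp0.le]
  simp only [enorm_eq_self]
  unfold fractionalMaximalConstant
  set q := Q * p / (Q - β * p) with hq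
  set I := ∫⁻ y, f y ^ p ∂μ with hI
  set K := maximalConstant cd p with hK
  have hK' := hμ.lintegral_fractionalMaximal_zero_rpow_le hl hcl hQ Ω hf hp
  -- The target exponent is forced: it brings the maximal function to the power `p`, and by `hexp`
  -- the two powers of `I` combine to the `L ^ p` norm.
  have hθq : (1 - β * p / Q) * q = p := by
    rw [hq]; field_simp
  have hexp : β / Q + 1 / q = 1 / p := by
    rw [hq]; field_simp; ring
  calc (∫⁻ x, fractionalMaximal μ β Ω f x ^ q ∂μ) ^ (1 / q)
      ≤ (((I / ENNReal.ofReal cl) ^ (β / Q)) ^ q * (K * I)) ^ (1 / q) := by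
        gcongr
        refine le_trans ?_ (mul_le_mul_right hK' _)
        rw [← lintegral_const_mul _ ((hμ.measurable_fractionalMaximal 0 Ω f).pow_const _)]
        refine lintegral_mono fun x => ?_
        have h := hμ.fractionalMaximal_le_mul_rpow hl hcl hQ Ω hf hp hβ hβQ x
        calc fractionalMaximal μ β Ω f x ^ q ≤ _ ^ q := ENNReal.rpow_le_rpow h hq0.le
          _ = _ := by
            rw [ENNReal.mul_rpow_of_nonneg _ _ hq0.le, ← ENNReal.rpow_mul _ (1 - β * p / Q), hθq]
    _ = (ENNReal.ofReal cl)⁻¹ ^ (β / Q) * K ^ (1 / q) * (I ^ (β / Q) * I ^ (1 / q)) := by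
        rw [ENNReal.mul_rpow_of_nonneg _ _ (by positivity), ← ENNReal.rpow_mul _ q,
          mul_one_div_cancel hq0.ne', ENNReal.rpow_one, ENNReal.mul_rpow_of_nonneg _ _ (by positivity),
          div_eq_mul_inv I, ENNReal.mul_rpow_of_nonneg _ _ (by positivity)]
        ring
    _ = _ := by
        rw [← ENNReal.rpow_add_of_nonneg _ _ (by positivity) (by positivity), hexp]

end FractionalMaximal

/-! ### Whitney balls and the discrete convolution at one scale -/

section Whitney

variable {X : Type*} [MetricSpace X] {Ω : Set X} {t : ℝ} {N : ℕ} {ν L : ℝ}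

theorem WhitneyCovering.infDist_center_pos (W : WhitneyCovering Ω t N) (hΩ : IsOpen Ω)
    (hΩc : Ωᶜ.Nonempty) (i : W.ι) : 0 < Metric.infDist (W.center i) Ωᶜ :=
  (hΩ.isClosed_compl.notMem_iff_infDist_pos hΩc).1 (by simpa using W.center_mem i)

theorem WhitneyCovering.radius_pos (W : WhitneyCovering Ω t N) (hΩ : IsOpen Ω)
    (hΩc : Ωᶜ.Nonempty) (ht : 0 < t) (i : W.ι) : 0 < W.radius i := by
  have := W.infDist_center_pos hΩ hΩc i
  unfold WhitneyCovering.radius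
  positivity

/-- The constant is `18 + 6`: the distance from the centre to the complement is `18 r_i / t`, moving
to `x` adds at most `6 r_i`, and `t < 1`. -/
theorem WhitneyCovering.mul_infDist_le (W : WhitneyCovering Ω t N) (ht0 : 0 < t) (ht1 : t < 1)
    {x : X} {i : W.ι} (hx : x ∈ Metric.ball (W.center i) (6 * W.radius i)) :
    t * Metric.infDist x Ωᶜ ≤ 24 * W.radius i := by
  have h1 := Metric.infDist_le_infDist_add_dist (s := Ωᶜ) (x := x) (y := W.center i)
  have h2 := Metric.mem_ball.1 hx
  have h3 : t * Metric.infDist x Ωᶜ ≤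
      t * (Metric.infDist (W.center i) Ωᶜ + dist x (W.center i)) := by gcongr
  have h4 : t * dist x (W.center i) ≤ 1 * dist x (W.center i) := by gcongr
  have h5 : 18 * W.radius i = t * Metric.infDist (W.center i) Ωᶜ := by
    unfold WhitneyCovering.radius; ring
  linarith

/-- The permitted displacement is at most one radius of every ball whose sixfold dilate contains
`x`, so one neighbourhood of `x` serves all these balls. -/
theorem WhitneyCovering.dist_center_lt (W : WhitneyCovering Ω t N) (ht0 : 0 < t) (ht1 : t < 1)
    {x z : X} {i : W.ι} (hx : x ∈ Metric.ball (W.center i) (6 * W.radius i))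
    (hxz : dist x z ≤ t * Metric.infDist x Ωᶜ / 24) : dist z (W.center i) < 7 * W.radius i := by
  have h1 := W.mul_infDist_le ht0 ht1 hx
  have h2 := Metric.mem_ball.1 hx
  have h3 := dist_triangle_left z (W.center i) x
  linarith

theorem WhitneyCovering.tsum_indicator_ball_le (W : WhitneyCovering Ω t N) {x : X} (hx : x ∈ Ω)
    (c : ℝ≥0∞) :
    ∑' i, {i | x ∈ Metric.ball (W.center i) (6 * W.radius i)}.indicator (fun _ => c) i ≤ N * c := by
  rw [← tsum_subtype, ENNReal.tsum_set_const]
  gcongr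
  exact_mod_cast W.overlap x hx

variable [MeasurableSpace X] {μ : Measure X} {cd : ℝ}

/-- The ball `B(z, 10 r_i)` contains `3 B_i` because `3 + 7 = 10`, and it is admissible because `z`
is more than `(18 - 7) r_i` from the complement. It lies in `17 B_i`, hence within three doublings
of `3 B_i`. -/
theorem WhitneyCovering.rpow_mul_laverage_le_fractionalMaximal (W : WhitneyCovering Ω t N)
    (hμ : IsDoublingMeasure μ cd) (hΩ : IsOpen Ω) (hΩc : Ωᶜ.Nonempty) (ht0 : 0 < t) (ht1 : t < 1)
    {β : ℝ} (hβ : 0 ≤ β) (f : X → ℝ≥0∞) {z : X} {i : W.ι}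
    (hz : dist z (W.center i) < 7 * W.radius i) :
    ENNReal.ofReal (W.radius i ^ β) *
        ⨍⁻ y in Metric.ball (W.center i) (3 * W.radius i), f y ∂μ ≤
      ENNReal.ofReal cd ^ 3 * fractionalMaximal μ β Ω f z := by
  have hr := W.radius_pos hΩ hΩc ht0 i
  have hc := W.infDist_center_pos hΩ hΩc i
  have h1 : 18 * W.radius i ≤ Metric.infDist (W.center i) Ωᶜ := by
    have : t * Metric.infDist (W.center i) Ωᶜ ≤ 1 * Metric.infDist (W.center i) Ωᶜ := by gcongr
    unfold WhitneyCovering.radius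
    linarith
  have h2 := Metric.infDist_le_infDist_add_dist (s := Ωᶜ) (x := W.center i) (y := z)
  rw [dist_comm] at h2
  have h3 : ENNReal.ofReal (10 * W.radius i) < Metric.infEDist z Ωᶜ := by
    rw [ENNReal.ofReal_lt_iff_lt_toReal (by positivity) (Metric.infEDist_ne_top hΩc)]
    change _ < Metric.infDist z Ωᶜ
    linarith
  have h4 := hμ.laverage_ball_le f (x := W.center i) (z := z) (s := 3 * W.radius i)
    (R := 10 * W.radius i) (by positivity) (by positivity) 3
    (by rw [dist_comm]; linarith) (by linarith)
  calc _ ≤ ENNReal.ofReal ((10 * W.radius i) ^ β) *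
        (ENNReal.ofReal cd ^ 3 * ⨍⁻ y in Metric.ball z (10 * W.radius i), f y ∂μ) := by
        gcongr
        linarith
    _ = ENNReal.ofReal cd ^ 3 * (ENNReal.ofReal ((10 * W.radius i) ^ β) *
          ⨍⁻ y in Metric.ball z (10 * W.radius i), f y ∂μ) := by ring
    _ ≤ _ := by
        gcongr
        exact le_fractionalMaximal μ β f (by positivity) h3

/-- A convex combination with weights `φ_i(x)`: only balls with `x` in `6 B_i` contribute, and each
of their coefficients obeys the same bound at `x`. -/
theorem discreteFractionalConvolution_le_fractionalMaximal (W : WhitneyCovering Ω t N)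
    (P : WhitneyPartition W ν L) (hμ : IsDoublingMeasure μ cd) (hΩ : IsOpen Ω)
    (hΩc : Ωᶜ.Nonempty) (ht0 : 0 < t) (ht1 : t < 1) {α : ℝ} (hα : 0 ≤ α) (u : X → ℝ) {x : X}
    (hx : x ∈ Ω) :
    discreteFractionalConvolution μ α W P u x ≤
      ENNReal.ofReal cd ^ 3 * fractionalMaximal μ α Ω (fun y => ‖u y‖ₑ) x := by
  have hsum : ∑' i, ENNReal.ofReal (P.φ i x) = 1 := by
    rw [← ENNReal.ofReal_tsum_of_nonneg (fun i => P.nonneg i x) (P.hasSum_one x hx).summable,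
      (P.hasSum_one x hx).tsum_eq, ENNReal.ofReal_one]
  calc discreteFractionalConvolution μ α W P u x
      ≤ ∑' i, ENNReal.ofReal (P.φ i x) *
        (ENNReal.ofReal cd ^ 3 * fractionalMaximal μ α Ω (fun y => ‖u y‖ₑ) x) := by
        refine ENNReal.tsum_le_tsum fun i => ?_
        rw [mul_assoc]
        by_cases hxi : x ∈ Metric.ball (W.center i) (6 * W.radius i)
        · refine mul_le_mul_right (W.rpow_mul_laverage_le_fractionalMaximal hμ hΩ hΩc ht0 ht1 hα
            (fun y => ‖u y‖ₑ) ?_) _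
          linarith [Metric.mem_ball.1 hxi, W.radius_pos hΩ hΩc ht0 i]
        · simp [P.eq_zero i x hxi]
    _ = _ := by rw [ENNReal.tsum_mul_right, hsum, one_mul]

/-- The local Lipschitz estimate for the discrete fractional convolution. -/
theorem discreteFractionalConvolution_le_add (W : WhitneyCovering Ω t N)
    (P : WhitneyPartition W ν L) (hL : 0 < L) (hμ : IsDoublingMeasure μ cd) (hΩ : IsOpen Ω)
    (hΩc : Ωᶜ.Nonempty) (ht0 : 0 < t) (ht1 : t < 1) {α : ℝ} (hα : 1 ≤ α) (u : X → ℝ) {x y z : X}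
    (hx : x ∈ Ω) (hxz : dist x z ≤ t * Metric.infDist x Ωᶜ / 24) :
    discreteFractionalConvolution μ α W P u x ≤ discreteFractionalConvolution μ α W P u y +
      ENNReal.ofReal (dist x y) * (N * ENNReal.ofReal L * ENNReal.ofReal cd ^ 3 *
        fractionalMaximal μ (α - 1) Ω (fun y => ‖u y‖ₑ) z) := by
  set M := fractionalMaximal μ (α - 1) Ω (fun y => ‖u y‖ₑ) z with hM
  set c := ENNReal.ofReal (dist x y) * (ENNReal.ofReal L * ENNReal.ofReal cd ^ 3 * M) with hc
  -- The estimate is one-sided: a term with `x` outside `6 B_i` vanishes at `x` and needs no error.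
  -- Thus only the at most `N` balls around `x` are counted, and `y` need not be close to `x`.
  have hterm : ∀ i, ENNReal.ofReal (P.φ i x) * ENNReal.ofReal (W.radius i ^ α) *
      ⨍⁻ y in Metric.ball (W.center i) (3 * W.radius i), ‖u y‖ₑ ∂μ ≤
      ENNReal.ofReal (P.φ i y) * ENNReal.ofReal (W.radius i ^ α) *
      ⨍⁻ y in Metric.ball (W.center i) (3 * W.radius i), ‖u y‖ₑ ∂μ +
      {i | x ∈ Metric.ball (W.center i) (6 * W.radius i)}.indicator (fun _ => c) i := fun i => by
    by_cases hxi : x ∈ Metric.ball (W.center i) (6 * W.radius i)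
    · rw [indicator_of_mem (by exact hxi)]
      have hr := W.radius_pos hΩ hΩc ht0 i
      set A := ⨍⁻ y in Metric.ball (W.center i) (3 * W.radius i), ‖u y‖ₑ ∂μ with hA
      have h1 : ENNReal.ofReal (W.radius i ^ (α - 1)) * A ≤ ENNReal.ofReal cd ^ 3 * M :=
        W.rpow_mul_laverage_le_fractionalMaximal hμ hΩ hΩc ht0 ht1 (by linarith) _
          (W.dist_center_lt ht0 ht1 hxi hxz)
      have h2 : ENNReal.ofReal (P.φ i x) ≤ ENNReal.ofReal (P.φ i y) +
          ENNReal.ofReal (L / W.radius i * dist x y) := by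
        refine le_trans (ENNReal.ofReal_le_ofReal ?_) ENNReal.ofReal_add_le
        linarith [le_abs_self (P.φ i x - P.φ i y), P.lipschitz i x y]
      -- The Lipschitz constant `L / r_i` uses up one power of the radius; this is why order `α - 1`
      -- appears.
      have h3 : ENNReal.ofReal (L / W.radius i * dist x y) * ENNReal.ofReal (W.radius i ^ α) =
          ENNReal.ofReal (dist x y) * ENNReal.ofReal L *
            ENNReal.ofReal (W.radius i ^ (α - 1)) := by
        have hd : 0 ≤ dist x y := dist_nonneg
        rw [← ENNReal.ofReal_mul (by positivity), ← ENNReal.ofReal_mul (by positivity),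
          ← ENNReal.ofReal_mul (by positivity), Real.rpow_sub_one hr.ne']
        congr 1
        field_simp
      calc ENNReal.ofReal (P.φ i x) * ENNReal.ofReal (W.radius i ^ α) * A
          ≤ (ENNReal.ofReal (P.φ i y) + ENNReal.ofReal (L / W.radius i * dist x y)) *
            ENNReal.ofReal (W.radius i ^ α) * A := by gcongr
        _ = ENNReal.ofReal (P.φ i y) * ENNReal.ofReal (W.radius i ^ α) * A +
            ENNReal.ofReal (dist x y) * (ENNReal.ofReal L *
              (ENNReal.ofReal (W.radius i ^ (α - 1)) * A)) := by
            rw [add_mul, add_mul, h3]; ring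
        _ ≤ ENNReal.ofReal (P.φ i y) * ENNReal.ofReal (W.radius i ^ α) * A +
            ENNReal.ofReal (dist x y) * (ENNReal.ofReal L * (ENNReal.ofReal cd ^ 3 * M)) := by
            gcongr
        _ = _ := by rw [hc]; ring
    · simp [P.eq_zero i x hxi]
  calc discreteFractionalConvolution μ α W P u x ≤ _ := ENNReal.tsum_le_tsum hterm
    _ ≤ discreteFractionalConvolution μ α W P u y + N * c := by
        rw [ENNReal.tsum_add]
        gcongr
        · exact le_rfl
        · exact W.tsum_indicator_ball_le hx c
    _ = _ := by rw [hc]; ring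

theorem measurable_discreteFractionalConvolution [OpensMeasurableSpace X]
    (W : WhitneyCovering Ω t N) (P : WhitneyPartition W ν L) (μ : Measure X) (α : ℝ)
    (u : X → ℝ) : Measurable (discreteFractionalConvolution μ α W P u) := by
  have := W.countable
  unfold discreteFractionalConvolution
  refine Measurable.tsum fun i => ((Measurable.ennreal_ofReal ?_).mul_const _).mul_const _
  refine (LipschitzWith.of_dist_le_mul (K := (L / W.radius i).toNNReal)
    fun x y => ?_).continuous.measurable
  rw [Real.dist_eq]
  refine (P.lipschitz i x y).trans ?_
  gcongr
  exact Real.le_coe_toNNReal _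

theorem measurable_discreteFractionalMaximal [OpensMeasurableSpace X]
    (W : ∀ t : Scale, WhitneyCovering Ω (t.1 : ℝ) N) (P : ∀ t : Scale, WhitneyPartition (W t) ν L)
    (μ : Measure X) (α : ℝ) (u : X → ℝ) :
    Measurable (discreteFractionalMaximal μ α W P u) :=
  Measurable.iSup fun t => measurable_discreteFractionalConvolution (W t) (P t) μ α u

theorem discreteFractionalMaximal_le_fractionalMaximal
    (W : ∀ t : Scale, WhitneyCovering Ω (t.1 : ℝ) N) (P : ∀ t : Scale, WhitneyPartition (W t) ν L)
    (hμ : IsDoublingMeasure μ cd) (hΩ : IsOpen Ω) (hΩc : Ωᶜ.Nonempty) {α : ℝ} (hα : 0 ≤ α)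
    (u : X → ℝ) {x : X} (hx : x ∈ Ω) :
    discreteFractionalMaximal μ α W P u x ≤
      ENNReal.ofReal cd ^ 3 * fractionalMaximal μ α Ω (fun y => ‖u y‖ₑ) x :=
  iSup_le fun t => discreteFractionalConvolution_le_fractionalMaximal (W t) (P t) hμ hΩ hΩc
    (by exact_mod_cast t.2.1) (by exact_mod_cast t.2.2) hα u hx

end Whitney

/-! ### From local increments to integrals on an interval -/

section LineIntegral

/-- The left side does not depend on `σ`, so the bound can be averaged over `(a, b]`. No
measurability of `k` is required. -/
theorem le_add_setLIntegral_of_forall_le_add {h h' : ℝ≥0∞} {k : ℝ → ℝ≥0∞} {a b : ℝ} (hab : a < b)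
    (H : ∀ σ ∈ Ioc a b, h ≤ h' + ENNReal.ofReal (b - a) * k σ) :
    h ≤ h' + ∫⁻ σ in Ioc a b, k σ := by
  have h0 : ENNReal.ofReal (b - a) ≠ 0 := by simpa using hab
  rw [← tsub_le_iff_left]
  calc h - h' = (h - h') / ENNReal.ofReal (b - a) * ENNReal.ofReal (b - a) :=
        (ENNReal.div_mul_cancel h0 ENNReal.ofReal_ne_top).symm
    _ = ∫⁻ σ in Ioc a b, (h - h') / ENNReal.ofReal (b - a) := by
        rw [setLIntegral_const, Real.volume_Ioc]
    _ ≤ ∫⁻ σ in Ioc a b, k σ := by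
        refine setLIntegral_mono' measurableSet_Ioc fun σ hσ => ?_
        rw [ENNReal.div_le_iff h0 ENNReal.ofReal_ne_top, tsub_le_iff_left, mul_comm]
        exact H σ hσ

/-- A function on an interval whose increments are locally bounded by `|s - s'| k(σ)` satisfies the
upper gradient inequality with `k`. -/
theorem le_add_setLIntegral_of_local_bound {h k : ℝ → ℝ≥0∞} {b δ : ℝ} (hb : 0 < b) (hδ : 0 < δ)
    (H : ∀ s ∈ Icc 0 b, ∀ s' ∈ Icc 0 b, ∀ σ ∈ Icc 0 b, |s - s'| ≤ δ → |s - σ| ≤ δ →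
      h s ≤ h s' + ENNReal.ofReal |s - s'| * k σ) :
    h 0 ≤ h b + ∫⁻ σ in Ioc 0 b, k σ ∧ h b ≤ h 0 + ∫⁻ σ in Ioc 0 b, k σ := by
  -- The interval is cut into `n` pieces of length at most `δ`; on each, every `σ` is admissible for
  -- both orders of the end points, so the averaged bound holds in both directions.
  obtain ⟨n, hn⟩ := exists_nat_gt (b / δ)
  have hn0 : (0 : ℝ) < n := lt_trans (by positivity) hn
  have hstep : b / n ≤ δ := by
    rw [div_le_iff₀ hn0]
    rw [div_lt_iff₀ hδ] at hn
    linarith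
  have hpos : 0 < b / n := by positivity
  have main : ∀ m : ℕ, m ≤ n →
      h 0 ≤ h (m * (b / n)) + ∫⁻ σ in Ioc 0 (m * (b / n)), k σ ∧
      h (m * (b / n)) ≤ h 0 + ∫⁻ σ in Ioc 0 (m * (b / n)), k σ := by
    intro m
    induction m with
    | zero => simp
    | succ m ih =>
      intro hm
      obtain ⟨ih1, ih2⟩ := ih (by omega)
      set s := m * (b / n) with hs
      have hs' : ((m + 1 : ℕ) : ℝ) * (b / n) = s + b / n := by push_cast; ring
      rw [hs']
      have hs0 : 0 ≤ s := by positivity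
      have hsb : s + b / n ≤ b := by
        rw [← hs']
        calc ((m + 1 : ℕ) : ℝ) * (b / n) ≤ n * (b / n) := by gcongr
          _ = b := by field_simp
      have hsplit : ∫⁻ σ in Ioc 0 (s + b / n), k σ =
          (∫⁻ σ in Ioc 0 s, k σ) + ∫⁻ σ in Ioc s (s + b / n), k σ := by
        rw [← lintegral_union measurableSet_Ioc (Ioc_disjoint_Ioc_of_le le_rfl),
          Ioc_union_Ioc_eq_Ioc hs0 (by linarith)]
      have k1 : h s ≤ h (s + b / n) + ∫⁻ σ in Ioc s (s + b / n), k σ := by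
        refine le_add_setLIntegral_of_forall_le_add (by linarith) fun σ hσ => ?_
        have h1 : |s - (s + b / n)| = s + b / n - s := by
          rw [abs_sub_comm, abs_of_pos (by linarith)]
        rw [← h1]
        refine H s ⟨hs0, by linarith⟩ _ ⟨by linarith, hsb⟩ σ
          ⟨by linarith [hσ.1], by linarith [hσ.2]⟩ (by rw [h1]; linarith) ?_
        rw [abs_le]
        constructor <;> linarith [hσ.1, hσ.2]
      have k2 : h (s + b / n) ≤ h s + ∫⁻ σ in Ioc s (s + b / n), k σ := by
        refine le_add_setLIntegral_of_forall_le_add (by linarith) fun σ hσ => ?_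
        have h1 : |s + b / n - s| = s + b / n - s := abs_of_pos (by linarith)
        rw [← h1]
        refine H _ ⟨by linarith, hsb⟩ s ⟨hs0, by linarith⟩ σ
          ⟨by linarith [hσ.1], by linarith [hσ.2]⟩ (by rw [h1]; linarith) ?_
        rw [abs_le]
        constructor <;> linarith [hσ.1, hσ.2]
      rw [hsplit]
      constructor
      · calc h 0 ≤ h s + ∫⁻ σ in Ioc 0 s, k σ := ih1
          _ ≤ (h (s + b / n) + ∫⁻ σ in Ioc s (s + b / n), k σ) + ∫⁻ σ in Ioc 0 s, k σ := by gcongr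
          _ = _ := by ring
      · calc h (s + b / n) ≤ h s + ∫⁻ σ in Ioc s (s + b / n), k σ := k2
          _ ≤ (h 0 + ∫⁻ σ in Ioc 0 s, k σ) + ∫⁻ σ in Ioc s (s + b / n), k σ := by gcongr
          _ = _ := by ring
  have := main n le_rfl
  rwa [mul_div_cancel₀ b hn0.ne'] at this

end LineIntegral

/-! ### Arc length parametrization, exceptional curves and modulus -/

namespace RectifiableCurve

variable {X : Type*} [MetricSpace X] (γ : RectifiableCurve X)

/-- The arc length parametrization of a curve. -/
noncomputable def arcLength : ℝ → X :=
  naturalParameterization γ.toFun (Icc γ.a γ.b) γ.a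

theorem left_mem : γ.a ∈ Icc γ.a γ.b := left_mem_Icc.2 γ.a_lt_b.le

theorem right_mem : γ.b ∈ Icc γ.a γ.b := right_mem_Icc.2 γ.a_lt_b.le

theorem locallyBoundedVariationOn : LocallyBoundedVariationOn γ.toFun (Icc γ.a γ.b) :=
  BoundedVariationOn.locallyBoundedVariationOn γ.rectifiable

theorem variationOnFromTo_right : variationOnFromTo γ.toFun (Icc γ.a γ.b) γ.a γ.b = γ.length := by
  rw [variationOnFromTo.eq_of_le _ _ γ.a_lt_b.le, inter_self]
  rfl

theorem length_pos : 0 < γ.length := by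
  obtain ⟨s, hs, t, ht, hst⟩ := γ.nonconstant
  refine ENNReal.toReal_pos (fun h => hst ?_) γ.rectifiable
  exact edist_eq_zero.1 ((eVariationOn.eq_zero_iff _).1 h s hs t ht)

/-- The one-sided limits of the variation differ from its value by the jumps of the curve, which
vanish by continuity. -/
theorem continuousOn_variationOnFromTo :
    ContinuousOn (variationOnFromTo γ.toFun (Icc γ.a γ.b) γ.a) (Icc γ.a γ.b) := by
  intro c hc
  have hcont := γ.continuousOn c hc
  have h1 := variationOnFromTo.tendsto_left γ.left_mem hc γ.locallyBoundedVariationOn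
    (hcont.mono_left (nhdsWithin_mono c inter_subset_left))
  have h2 := variationOnFromTo.tendsto_right γ.left_mem hc γ.locallyBoundedVariationOn
    (hcont.mono_left (nhdsWithin_mono c inter_subset_left))
  rw [dist_self, sub_zero] at h1
  rw [dist_self, add_zero] at h2
  have hset : Icc γ.a γ.b = (Icc γ.a γ.b ∩ Iio c) ∪ (Icc γ.a γ.b ∩ Ioi c) ∪ {c} := by
    ext x
    simp only [mem_union, mem_inter_iff, mem_Iio, mem_Ioi, mem_singleton_iff]
    constructor
    · intro hx
      rcases lt_trichotomy x c with h | h | h <;> simp [h, hx]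
    · rintro ((h | h) | rfl)
      exacts [h.1, h.1, hc]
  rw [ContinuousWithinAt, hset, nhdsWithin_union, nhdsWithin_union, nhdsWithin_singleton]
  rw [← hset]
  exact (h1.sup h2).sup (tendsto_pure_nhds _ _)

/-- `naturalParameterization` inverts the variation and is meaningful only on its range; the
intermediate value theorem shows that the range includes all of `[0, length]`. -/
theorem Icc_subset_image_variationOnFromTo :
    Icc 0 γ.length ⊆ variationOnFromTo γ.toFun (Icc γ.a γ.b) γ.a '' Icc γ.a γ.b := by
  have h := intermediate_value_Icc γ.a_lt_b.le γ.continuousOn_variationOnFromTo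
  rwa [variationOnFromTo.self, γ.variationOnFromTo_right] at h

theorem arcLength_variationOnFromTo {c : ℝ} (hc : c ∈ Icc γ.a γ.b) :
    γ.arcLength (variationOnFromTo γ.toFun (Icc γ.a γ.b) γ.a c) = γ.toFun c :=
  edist_eq_zero.1 (edist_naturalParameterization_eq_zero γ.locallyBoundedVariationOn γ.left_mem hc)

theorem arcLength_zero : γ.arcLength 0 = γ.toFun γ.a := by
  rw [← γ.arcLength_variationOnFromTo γ.left_mem, variationOnFromTo.self]

theorem arcLength_length : γ.arcLength γ.length = γ.toFun γ.b := by
  rw [← γ.arcLength_variationOnFromTo γ.right_mem, γ.variationOnFromTo_right]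

theorem arcLength_mem_image {s : ℝ} (hs : s ∈ Icc 0 γ.length) : γ.arcLength s ∈ γ.image := by
  obtain ⟨c, hc, rfl⟩ := γ.Icc_subset_image_variationOnFromTo hs
  rw [γ.arcLength_variationOnFromTo hc]
  exact mem_image_of_mem _ hc

/-- Unit speed: the variation between the two parameters is their difference, and it dominates the
distance. -/
theorem dist_arcLength_le {s s' : ℝ} (hs : s ∈ Icc 0 γ.length) (hs' : s' ∈ Icc 0 γ.length) :
    dist (γ.arcLength s) (γ.arcLength s') ≤ |s - s'| := by
  wlog h : s ≤ s' generalizing s s'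
  · rw [dist_comm, abs_sub_comm]
    exact this hs' hs (le_of_not_ge h)
  have hu := has_unit_speed_naturalParameterization γ.toFun γ.locallyBoundedVariationOn γ.left_mem
    (γ.Icc_subset_image_variationOnFromTo hs) (γ.Icc_subset_image_variationOnFromTo hs')
  rw [abs_sub_comm, abs_of_nonneg (by linarith),
    ← ENNReal.ofReal_le_ofReal_iff (by linarith), ← edist_dist]
  rw [NNReal.coe_one, one_mul] at hu
  rw [← hu]
  exact eVariationOn.edist_le _
    ⟨γ.Icc_subset_image_variationOnFromTo hs, left_mem_Icc.2 h⟩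
    ⟨γ.Icc_subset_image_variationOnFromTo hs', right_mem_Icc.2 h⟩

theorem isCompact_image : IsCompact γ.image :=
  isCompact_Icc.image_of_continuousOn γ.continuousOn

theorem image_nonempty : γ.image.Nonempty := ⟨_, mem_image_of_mem _ γ.left_mem⟩

/-- The upper gradient inequality along the initial pieces of a curve, for a function which is
locally Lipschitz on the curve with a local constant bounded by `g`. -/
theorem le_add_lineIntegral_of_local_bound {w g : X → ℝ≥0∞} {δ : ℝ} (hδ : 0 < δ)
    (H : ∀ x ∈ γ.image, ∀ y z, dist x z ≤ δ → w x ≤ w y + ENNReal.ofReal (dist x y) * g z)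
    {s : ℝ} (hs : s ∈ Icc 0 γ.length) :
    w (γ.toFun γ.a) ≤ w (γ.arcLength s) + γ.lineIntegral g ∧
      w (γ.arcLength s) ≤ w (γ.toFun γ.a) + γ.lineIntegral g := by
  rw [← γ.arcLength_zero]
  rcases hs.1.eq_or_lt with rfl | hs0
  · exact ⟨le_self_add, le_self_add⟩
  have hI : ∫⁻ σ in Ioc 0 s, g (γ.arcLength σ) ≤ γ.lineIntegral g :=
    lintegral_mono_set fun σ hσ => ⟨hσ.1.le, hσ.2.trans hs.2⟩
  have hsub : Icc 0 s ⊆ Icc 0 γ.length := Icc_subset_Icc_right hs.2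
  obtain ⟨h1, h2⟩ := le_add_setLIntegral_of_local_bound (h := fun σ => w (γ.arcLength σ))
    (k := fun σ => g (γ.arcLength σ)) hs0 hδ fun s₁ hs₁ s₂ hs₂ σ hσ _ hd =>
      (H _ (γ.arcLength_mem_image (hsub hs₁)) (γ.arcLength s₂) (γ.arcLength σ)
        ((γ.dist_arcLength_le (hsub hs₁) (hsub hσ)).trans hd)).trans (by
          gcongr
          exact γ.dist_arcLength_le (hsub hs₁) (hsub hs₂))
  exact ⟨h1.trans (by gcongr), h2.trans (by gcongr)⟩

/-- A curve along which `v` obeys a two-sided bound satisfies the upper gradient inequality, unless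
`v` is infinite on the whole curve. -/
theorem eq_top_of_not_upperGradientInequality {v g : X → ℝ≥0∞}
    (H : ∀ s ∈ Icc 0 γ.length, v (γ.toFun γ.a) ≤ v (γ.arcLength s) + γ.lineIntegral g ∧
      v (γ.arcLength s) ≤ v (γ.toFun γ.a) + γ.lineIntegral g)
    (hγ : ¬ UpperGradientInequality (fun x => (v x : EReal)) g γ) :
    ∀ s ∈ Icc 0 γ.length, v (γ.arcLength s) = ∞ := by
  have hend := H γ.length (right_mem_Icc.2 γ.length_pos.le)
  rw [γ.arcLength_length] at hend
  set I := γ.lineIntegral g with hI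
  -- An infinite line integral satisfies the inequality in both cases, so failure forces it to be
  -- finite. A finite initial value would then make the final value finite and the inequality true;
  -- hence the initial value is infinite, and this spreads along the curve.
  have hItop : I ≠ ∞ := fun h => hγ ⟨fun _ => by rw [← hI, h]; exact le_top, fun _ => h⟩
  have htop : v (γ.toFun γ.a) = ∞ := by
    by_contra ha
    have hb : v (γ.toFun γ.b) ≠ ∞ := ne_top_of_le_ne_top (ENNReal.add_ne_top.2 ⟨ha, hItop⟩) hend.2
    refine hγ ⟨fun _ => ?_, fun h => absurd ?_ h⟩
    · simp only [EReal.toReal_coe_ennreal]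
      rw [← hI, ← ENNReal.ofReal_toReal hItop]
      refine ENNReal.ofReal_le_ofReal (abs_sub_le_iff.2 ⟨?_, ?_⟩)
      · have := ENNReal.toReal_mono (ENNReal.add_ne_top.2 ⟨hb, hItop⟩) hend.1
        rw [ENNReal.toReal_add hb hItop] at this
        linarith
      · have := ENNReal.toReal_mono (ENNReal.add_ne_top.2 ⟨ha, hItop⟩) hend.2
        rw [ENNReal.toReal_add ha hItop] at this
        linarith
    · simp [ha, hb]
  intro s hs
  have h := (H s hs).1
  rw [htop, top_le_iff, ENNReal.add_eq_top] at h
  exact h.resolve_right hItop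

end RectifiableCurve

/-- A family of curves that lie entirely in a null set has zero modulus. -/
theorem curveModulus_eq_zero_of_forall_mem {X : Type*} [MetricSpace X] [MeasurableSpace X]
    {μ : Measure X} {s : ℝ} (hs : 0 < s) {E : Set X} (hE : MeasurableSet E) (hE0 : μ E = 0)
    {Γ : Set (RectifiableCurve X)}
    (hΓ : ∀ γ ∈ Γ, ∀ σ ∈ Icc 0 γ.length, γ.arcLength σ ∈ E) : curveModulus μ s Γ = 0 := by
  rw [← nonpos_iff_eq_zero]
  -- The test function is infinite on `E`: its integral vanishes since `E` is null, while its line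
  -- integrals are infinite since nonconstant curves have positive length.
  refine iInf₂_le_of_le (E.indicator fun _ => ∞) (measurable_const.indicator hE)
    (iInf_le_of_le (fun γ hγ => ?_) (le_of_eq ?_))
  · have h : γ.lineIntegral (E.indicator fun _ => ∞) = ∞ := by
      calc ∫⁻ σ in Icc 0 γ.length, E.indicator (fun _ => ∞) (γ.arcLength σ)
          = ∫⁻ σ in Icc 0 γ.length, ∞ :=
            setLIntegral_congr_fun measurableSet_Icc fun σ hσ => indicator_of_mem (hΓ γ hγ σ hσ) _
        _ = ∞ := by
            rw [setLIntegral_const, Real.volume_Icc, sub_zero, ENNReal.top_mul]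
            simpa using γ.length_pos
    rw [h]
    exact le_top
  · rw [lintegral_eq_zero_iff ((measurable_const.indicator hE).pow_const s)]
    have : ∀ᵐ x ∂μ, x ∉ E := measure_eq_zero_iff_ae_notMem.1 hE0
    filter_upwards [this] with x hx
    simp [hx, hs]

/-! ### The local estimates and the weak upper gradient -/

section Main

variable {X : Type*} [MetricSpace X] [MeasurableSpace X] [BorelSpace X] {μ : Measure X}
  {cd cl Q : ℝ} {Ω : Set X} {N : ℕ} {ν L : ℝ}

/-- The global estimate wants a measurable function on `X`, so `|u|` is replaced by a measurable
representative cut off to `Ω`; this leaves the local maximal function unchanged. -/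
theorem IsDoublingMeasure.eLpNorm_localFractionalMaximal_restrict_le (hμ : IsDoublingMeasure μ cd)
    (hl : MeasureLowerBound μ cl Q) (hcl : 0 < cl) (hQ : 0 < Q) (hΩ : IsOpen Ω) {u : X → ℝ}
    {p β : ℝ} (hu : AEStronglyMeasurable u (μ.restrict Ω)) (hp : 1 < p) (hβ : 0 ≤ β)
    (hβQ : β < Q / p) :
    eLpNorm (localFractionalMaximal μ β Ω u) (ENNReal.ofReal (Q * p / (Q - β * p)))
        (μ.restrict Ω) ≤
      fractionalMaximalConstant cd cl Q p β * eLpNorm u (ENNReal.ofReal p) (μ.restrict Ω) := by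
  set g : X → ℝ≥0∞ := fun y => ‖hu.mk u y‖ₑ with hg
  have hgm : Measurable g := hu.stronglyMeasurable_mk.measurable.enorm
  have hgu : (fun y => ‖u y‖ₑ) =ᵐ[μ.restrict Ω] g := by
    filter_upwards [hu.ae_eq_mk] with y hy
    simp only [hg, ← hy]
  have hind : Ω.indicator g =ᵐ[μ.restrict Ω] fun y => ‖u y‖ₑ :=
    (indicator_ae_eq_restrict hΩ.measurableSet).trans hgu.symm
  calc eLpNorm (localFractionalMaximal μ β Ω u) (ENNReal.ofReal (Q * p / (Q - β * p)))
        (μ.restrict Ω)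
      = eLpNorm (fractionalMaximal μ β Ω (Ω.indicator g))
          (ENNReal.ofReal (Q * p / (Q - β * p))) (μ.restrict Ω) := by
        rw [fractionalMaximal_congr β hind]
        rfl
    _ ≤ fractionalMaximalConstant cd cl Q p β * eLpNorm (Ω.indicator g) (ENNReal.ofReal p) μ :=
        (eLpNorm_mono_measure _ Measure.restrict_le_self).trans
          (hμ.eLpNorm_fractionalMaximal_le hl hcl hQ Ω (hgm.indicator hΩ.measurableSet) hp hβ hβQ)
    _ = _ := by
        rw [eLpNorm_indicator_eq_eLpNorm_restrict hΩ.measurableSet, ← eLpNorm_congr_ae hgu,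
          eLpNorm_enorm]

theorem IsDoublingMeasure.eLpNorm_discreteFractionalMaximal_le (hμ : IsDoublingMeasure μ cd)
    (hl : MeasureLowerBound μ cl Q) (hcl : 0 < cl) (hQ : 0 < Q) (hΩ : IsOpen Ω)
    (hΩc : Ωᶜ.Nonempty) (W : ∀ t : Scale, WhitneyCovering Ω (t.1 : ℝ) N)
    (P : ∀ t : Scale, WhitneyPartition (W t) ν L) {u : X → ℝ} {p α : ℝ}
    (hu : AEStronglyMeasurable u (μ.restrict Ω)) (hp : 1 < p) (hα : 0 ≤ α) (hαQ : α < Q / p) :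
    eLpNorm (discreteFractionalMaximal μ α W P u) (ENNReal.ofReal (Q * p / (Q - α * p)))
        (μ.restrict Ω) ≤
      ENNReal.ofReal cd ^ 3 * fractionalMaximalConstant cd cl Q p α *
        eLpNorm u (ENNReal.ofReal p) (μ.restrict Ω) := by
  rw [mul_assoc]
  refine le_trans ?_ (mul_le_mul_right
    (hμ.eLpNorm_localFractionalMaximal_restrict_le hl hcl hQ hΩ hu hp hα hαQ) _)
  have hc : ENNReal.ofReal cd ^ 3 = ((cd.toNNReal ^ 3 : NNReal) : ℝ≥0∞) := by
    rw [ENNReal.coe_pow]; rfl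
  rw [hc]
  refine eLpNorm_le_nnreal_smul_eLpNorm_of_ae_le_mul' ?_ _
  filter_upwards [ae_restrict_mem hΩ.measurableSet] with x hx
  rw [enorm_eq_self, enorm_eq_self, ← hc]
  exact discreteFractionalMaximal_le_fractionalMaximal W P hμ hΩ hΩc hα u hx

/-- Almost everywhere finiteness serves only to discard the curves on which the discrete maximal
function is identically infinite; all other curves in `Ω` satisfy the inequality. -/
theorem IsDoublingMeasure.isWeakUpperGradientOn_discreteFractionalMaximal
    (hμ : IsDoublingMeasure μ cd) (hΩ : IsOpen Ω) (hΩc : Ωᶜ.Nonempty) (hL : 0 < L)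
    (W : ∀ t : Scale, WhitneyCovering Ω (t.1 : ℝ) N) (P : ∀ t : Scale, WhitneyPartition (W t) ν L)
    {u : X → ℝ} {α s : ℝ} {c : ℝ≥0∞} (hα : 1 ≤ α) (hs : 0 < s)
    (hc : N * ENNReal.ofReal L * ENNReal.ofReal cd ^ 3 ≤ c)
    (hfin : ∀ᵐ x ∂μ.restrict Ω, discreteFractionalMaximal μ α W P u x ≠ ∞) :
    IsWeakUpperGradientOn μ s Ω (fun x => (discreteFractionalMaximal μ α W P u x : EReal))
      (fun x => c * localFractionalMaximal μ (α - 1) Ω u x) := by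
  have hvm := measurable_discreteFractionalMaximal W P μ α u
  refine ⟨((hμ.measurable_fractionalMaximal (α - 1) Ω _).const_mul c).aemeasurable, ?_⟩
  set v := discreteFractionalMaximal μ α W P u with hv
  have hE : MeasurableSet ({x | v x = ∞} ∩ Ω) :=
    (hvm (measurableSet_singleton ∞)).inter hΩ.measurableSet
  refine curveModulus_eq_zero_of_forall_mem hs hE ?_ ?_
  · rw [ae_iff, Measure.restrict_apply' hΩ.measurableSet] at hfin
    simpa using hfin
  · rintro γ ⟨hγΩ, hγ⟩ σ hσ
    refine ⟨?_, hγΩ (γ.arcLength_mem_image hσ)⟩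
    refine γ.eq_top_of_not_upperGradientInequality (fun σ hσ => ?_) hγ σ hσ
    -- The image is compact in `Ω`, so its distance to the complement has a positive minimum, which
    -- yields one step size `δ` for the whole curve at each scale.
    obtain ⟨x₀, hx₀, hmin⟩ := γ.isCompact_image.exists_isMinOn γ.image_nonempty
      (Metric.continuous_infDist_pt Ωᶜ).continuousOn
    have hd0 : 0 < Metric.infDist x₀ Ωᶜ :=
      (hΩ.isClosed_compl.notMem_iff_infDist_pos hΩc).1 (by simpa using hγΩ hx₀)
    -- Only `δ` depends on `t`; the line integral does not, so the supremum over scales can be taken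
    -- afterwards on both sides.
    have key : ∀ t : Scale,
        discreteFractionalConvolution μ α (W t) (P t) u (γ.toFun γ.a) ≤
          discreteFractionalConvolution μ α (W t) (P t) u (γ.arcLength σ) +
            γ.lineIntegral (fun x => c * localFractionalMaximal μ (α - 1) Ω u x) ∧
        discreteFractionalConvolution μ α (W t) (P t) u (γ.arcLength σ) ≤
          discreteFractionalConvolution μ α (W t) (P t) u (γ.toFun γ.a) +
            γ.lineIntegral (fun x => c * localFractionalMaximal μ (α - 1) Ω u x) := fun t => by
      have ht0 : (0 : ℝ) < t.1 := by exact_mod_cast t.2.1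
      have ht1 : (t.1 : ℝ) < 1 := by exact_mod_cast t.2.2
      refine γ.le_add_lineIntegral_of_local_bound
        (δ := (t.1 : ℝ) * Metric.infDist x₀ Ωᶜ / 24) (by positivity) (fun x hx y z hxz => ?_) hσ
      refine (discreteFractionalConvolution_le_add (W t) (P t) hL hμ hΩ hΩc ht0 ht1 hα u
        (y := y) (hγΩ hx) (hxz.trans ?_)).trans ?_
      · have : Metric.infDist x₀ Ωᶜ ≤ Metric.infDist x Ωᶜ := hmin hx
        gcongr
      · gcongr
        exact le_rfl
    exact ⟨iSup_le fun t => (key t).1.trans (by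
        gcongr
        exact le_iSup (fun t => discreteFractionalConvolution μ α (W t) (P t) u _) t),
      iSup_le fun t => (key t).2.trans (by
        gcongr
        exact le_iSup (fun t => discreteFractionalConvolution μ α (W t) (P t) u _) t)⟩

end Main

theorem mainTheorem5
    -- the parameters on which the constant may depend; `N`, `ν`, `L` are the constants of the
    -- Whitney coverings and of the partitions of unity
    (cd cl Q p α : ℝ) (hcl : 0 < cl) (hp : 1 < p) (hpQ : p < Q) (hα : 1 ≤ α) (hαQ : α < Q / p)
    (N : ℕ) (ν L : ℝ) (hν : 0 < ν) (hL : 0 < L) :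
    ∃ C : ℝ, 0 < C ∧
      ∀ (X : Type*) [MetricSpace X] [MeasurableSpace X] [BorelSpace X] (μ : Measure X)
        (Ω : Set X) (u : X → ℝ)
        (W : ∀ t : Scale, WhitneyCovering Ω (t.1 : ℝ) N)
        (P : ∀ t : Scale, WhitneyPartition (W t) ν L),
        IsDoublingMeasure μ cd → MeasureLowerBound μ cl Q →
        IsOpen Ω → Ωᶜ.Nonempty → MemLp u (ENNReal.ofReal p) (μ.restrict Ω) →
        (∀ s : ℝ, 1 ≤ s → IsWeakUpperGradientOn μ s Ω
          (fun x => (discreteFractionalMaximal μ α W P u x : EReal))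
          (fun x => ENNReal.ofReal C * localFractionalMaximal μ (α - 1) Ω u x)) ∧
        AEMeasurable (discreteFractionalMaximal μ α W P u) (μ.restrict Ω) ∧
        eLpNorm (discreteFractionalMaximal μ α W P u)
            (ENNReal.ofReal (Q * p / (Q - α * p))) (μ.restrict Ω) ≤
          ENNReal.ofReal C * eLpNorm u (ENNReal.ofReal p) (μ.restrict Ω) ∧
        AEMeasurable (localFractionalMaximal μ (α - 1) Ω u) (μ.restrict Ω) ∧
        eLpNorm (localFractionalMaximal μ (α - 1) Ω u)
            (ENNReal.ofReal (Q * p / (Q - (α - 1) * p))) (μ.restrict Ω) ≤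
          ENNReal.ofReal C * eLpNorm u (ENNReal.ofReal p) (μ.restrict Ω) := by
  have hp0 : 0 < p := by linarith
  have hQ : 0 < Q := by linarith
  have hα0 : 0 ≤ α := by linarith
  have hα1 : 0 ≤ α - 1 := by linarith
  have hαQ1 : α - 1 < Q / p := by linarith
  set κ₁ : ℝ≥0∞ := N * ENNReal.ofReal L * ENNReal.ofReal cd ^ 3 with hκ₁
  set κ₂ : ℝ≥0∞ := ENNReal.ofReal cd ^ 3 * fractionalMaximalConstant cd cl Q p α with hκ₂
  set κ₃ : ℝ≥0∞ := fractionalMaximalConstant cd cl Q p (α - 1) with hκ₃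
  have h1 : κ₁ ≠ ∞ := by finiteness
  have h2 : κ₂ ≠ ∞ :=
    ENNReal.mul_ne_top (by finiteness) (fractionalMaximalConstant_ne_top cd hcl hp hQ hα0 hαQ)
  have h3 : κ₃ ≠ ∞ := fractionalMaximalConstant_ne_top cd hcl hp hQ hα1 hαQ1
  -- One constant dominates all three; the added 1 makes it strictly positive.
  have hC : κ₁ + κ₂ + κ₃ ≤ ENNReal.ofReal ((κ₁ + κ₂ + κ₃).toReal + 1) := by
    rw [← ENNReal.ofReal_toReal (show κ₁ + κ₂ + κ₃ ≠ ∞ by finiteness)]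
    rw [ENNReal.toReal_ofReal ENNReal.toReal_nonneg]
    exact ENNReal.ofReal_le_ofReal (by linarith)
  refine ⟨(κ₁ + κ₂ + κ₃).toReal + 1, by positivity, ?_⟩
  intro X _ _ _ μ Ω u W P hμ hl hΩ hΩc hu
  have hc1 := (le_self_add.trans le_self_add).trans hC
  have hc2 := (le_add_self.trans le_self_add).trans hC
  have hc3 := le_add_self.trans hC
  have hv := hμ.eLpNorm_discreteFractionalMaximal_le hl hcl hQ hΩ hΩc W P hu.1 hp hα0 hαQ
  have hM := hμ.eLpNorm_localFractionalMaximal_restrict_le hl hcl hQ hΩ hu.1 hp hα1 hαQ1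
  have hvm := measurable_discreteFractionalMaximal W P μ α u
  refine ⟨fun s hs => ?_, hvm.aemeasurable, hv.trans (by gcongr),
    (hμ.measurable_fractionalMaximal (α - 1) Ω _).aemeasurable, hM.trans (by gcongr)⟩
  refine hμ.isWeakUpperGradientOn_discreteFractionalMaximal hΩ hΩc hL W P hα
    (by linarith) hc1 ?_
  have hq : 0 < Q * p / (Q - α * p) := by
    have : 0 < Q - α * p := sub_pos.2 ((lt_div_iff₀ hp0).1 hαQ)
    positivity
  -- The norm estimate is reused qualitatively: a function with finite norm is finite almost
  -- everywhere.
  have hfin : eLpNorm (discreteFractionalMaximal μ α W P u)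
      (ENNReal.ofReal (Q * p / (Q - α * p))) (μ.restrict Ω) < ∞ :=
    hv.trans_lt (ENNReal.mul_lt_top h2.lt_top hu.2)
  have hlt := lintegral_rpow_enorm_lt_top_of_eLpNorm_lt_top (by simpa using hq)
    ENNReal.ofReal_ne_top hfin
  rw [ENNReal.toReal_ofReal hq.le] at hlt
  filter_upwards [ae_lt_top (hvm.enorm.pow_const _) hlt.ne] with x hx h
  rw [enorm_eq_self, h, ENNReal.top_rpow_of_pos hq] at hx
  exact hx.ne rfl
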